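/- **Theorem 3.4.** Throughout, Banach lattices are real, duals carry their usual order ($f\ge 0$ iff $f(x)\ge 0$ for all $x\ge 0$), and operators between them carry the operator norm and the pointwise order. A Banach lattice $X$ has the *positive Schur property* (PSP) if $\|x_n\|\to 0$ for every weakly null sequence $(x_n)$ of positive elements of $X$. An operator is *regular* if it is a difference of two positive operators. A linear subspace $\mathcal X$ of the space $\mathcal L^r(A;B)$ of regular operators between Banach lattices $A$, $B$ has the *wot-PSP* if for every sequence $(T_n)$ of positive operators in $\mathcal X$ such that $\langle b^*,T_n a\rangle\to 0$ for all $a\in A$ and $b^*\in B^*$, one has $\|T_n\|\to 0$. For Banach lattices $E$ and $F$, $\mathcal L^r_{w^*}(F^{**};E^*)$ denotes the space of all regular operators $F^{**}\to E^*$ that are continuous from $\sigma(F^{**},F^*)$ to $\sigma(E^*,E)$. Finally, $E\hat\otimes_{|\pi|}F$ denotes the positive projective tensor product, that is, the completion (a Banach lattice) of Fremlin's Archimedean vector lattice tensor product $E\bar\otimes F$, the Archimedean vector lattice universal for bilinear maps $\psi$ on $E\times F$ into Archimedean vector lattices with $|\psi(x,y)|=\psi(|x|,|y|)$, under the norm $$\|u\|_{|\pi|}=\inf\Big\{\sum_{k=1}^n\|x_k\|\,\|y_k\|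 : n\in\mathbb N,\ x_k\in E^+,\ y_k\in F^+,\ |u|\le\sum_{k=1}^n x_k\otimes y_k\Big\}.$$ Let $E$ and $F$ be nonzero Banach lattices. The following are equivalent: 1. $E^*$ and $F^*$ have the PSP. 2. $\mathcal L^r_{w^*}(F^{**};E^*)$ has the wot-PSP. 3. $(E\hat\otimes_{|\pi|}F)^*$ has the PSP. -/

import Mathlib

open Filter Topology UniformSpace

noncomputable section

universe u v

/-! ### Order on the dual, positive Schur property -/

/-- The usual (pre)order on the topological dual of an ordered normed space: `f ≤ g` iff
`f x ≤ g x` for every `x ≥ 0`. -/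
instance dualPreorder (X : Type*) [NormedAddCommGroup X] [NormedSpace ℝ X] [Preorder X] :
    Preorder (StrongDual ℝ X) where
  le f g := ∀ x : X, 0 ≤ x → f x ≤ g x
  le_refl _ _ _ := le_rfl
  le_trans _ _ _ hfg hgh x hx := (hfg x hx).trans (hgh x hx)

theorem dual_nonneg_iff {X : Type*} [NormedAddCommGroup X] [NormedSpace ℝ X] [Preorder X]
    {f : StrongDual ℝ X} : 0 ≤ f ↔ ∀ x : X, 0 ≤ x → 0 ≤ f x := Iff.rfl

/-- The positive Schur property (PSP): every weakly null sequence of positive elements is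
norm null. -/
def HasPSP (X : Type*) [NormedAddCommGroup X] [NormedSpace ℝ X] [Preorder X] : Prop :=
  ∀ x : ℕ → X, (∀ n, 0 ≤ x n) →
    (∀ f : StrongDual ℝ X, Tendsto (fun n => f (x n)) atTop (𝓝 0)) →
    Tendsto (fun n => ‖x n‖) atTop (𝓝 0)

/-! ### Regular operators and the wot-PSP -/

section Operators

variable {A B : Type*} [NormedAddCommGroup A] [NormedSpace ℝ A] [Preorder A]
  [NormedAddCommGroup B] [NormedSpace ℝ B] [Preorder B]

/-- A positive operator maps positive elements to positive elements. -/
def IsPositiveOperator (T : A →L[ℝ] B) : Prop := ∀ a : A, 0 ≤ a → 0 ≤ T a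

/-- A regular operator is a difference of two positive operators. -/
def IsRegularOperator (T : A →L[ℝ] B) : Prop :=
  ∃ P Q : A →L[ℝ] B, IsPositiveOperator P ∧ IsPositiveOperator Q ∧ T = P - Q

/-- A subspace `S` of operators has the wot-PSP if every sequence of positive operators in `S`
that tends to `0` in the weak operator topology tends to `0` in the operator norm. -/
def HasWotPSP (S : Submodule ℝ (A →L[ℝ] B)) : Prop :=
  ∀ T : ℕ → A →L[ℝ] B, (∀ n, T n ∈ S) → (∀ n, IsPositiveOperator (T n)) →
    (∀ (a : A) (g : StrongDual ℝ B), Tendsto (fun n => g (T n a)) atTop (𝓝 0)) →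
    Tendsto (fun n => ‖T n‖) atTop (𝓝 0)

end Operators

/-- `T : X* → Y*` is weak*-weak* continuous. -/
def IsWeakStarContinuous {X Y : Type*} [NormedAddCommGroup X] [NormedSpace ℝ X]
    [NormedAddCommGroup Y] [NormedSpace ℝ Y]
    (T : StrongDual ℝ X →L[ℝ] StrongDual ℝ Y) : Prop :=
  Continuous fun φ : WeakDual ℝ X => StrongDual.toWeakDual (T (WeakDual.toStrongDual φ))

/-- The space of regular weak*-weak* continuous operators from `X*` to `Y*`. -/
def regularWeakStarOperators (X Y : Type*) [NormedAddCommGroup X] [NormedSpace ℝ X] [Preorder X]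
    [NormedAddCommGroup Y] [NormedSpace ℝ Y] [Preorder Y] :
    Submodule ℝ (StrongDual ℝ X →L[ℝ] StrongDual ℝ Y) where
  carrier := {T | IsRegularOperator T ∧ IsWeakStarContinuous T}
  zero_mem' := ⟨⟨0, 0, fun _ _ => le_rfl, fun _ _ => le_rfl, by simp⟩, by
    simpa [IsWeakStarContinuous] using continuous_const⟩
  add_mem' := by
    rintro S T ⟨⟨P, Q, hP, hQ, rfl⟩, hS⟩ ⟨⟨P', Q', hP', hQ', rfl⟩, hT⟩
    refine ⟨⟨P + P', Q + Q', fun a ha x hx => ?_, fun a ha x hx => ?_, by abel⟩, ?_⟩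
    · simpa using add_nonneg (hP a ha x hx) (hP' a ha x hx)
    · simpa using add_nonneg (hQ a ha x hx) (hQ' a ha x hx)
    · exact (hS.add hT).congr fun φ => by simp
  smul_mem' := by
    rintro c T ⟨⟨P, Q, hP, hQ, rfl⟩, hT⟩
    refine ⟨?_, ?_⟩
    · rcases le_total 0 c with hc | hc
      · refine ⟨c • P, c • Q, fun a ha x hx => ?_, fun a ha x hx => ?_, smul_sub c P Q⟩
        · exact mul_nonneg hc (hP a ha x hx)
        · exact mul_nonneg hc (hQ a ha x hx)
      · refine ⟨(-c) • Q, (-c) • P, fun a ha x hx => ?_, fun a ha x hx => ?_, by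
          ext a x; simp; ring⟩
        · exact mul_nonneg (neg_nonneg.2 hc) (hQ a ha x hx)
        · exact mul_nonneg (neg_nonneg.2 hc) (hP a ha x hx)
    · exact (hT.const_smul c).congr fun φ => by simp

/-! ### The Archimedean vector lattice tensor product -/

/-- A vector lattice is Archimedean if `n x ≤ y` for all `n` forces `x ≤ 0`. (This is the notion
for vector lattices, weaker than Mathlib's `Archimedean`, which is meant for linear orders.) -/
def IsArchimedeanLattice (G : Type*) [AddCommGroup G] [Lattice G] : Prop :=
  ∀ x y : G, (∀ n : ℕ, n • x ≤ y) → x ≤ 0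

/-- A lattice bimorphism is a bilinear map with `|ψ (x, y)| = ψ (|x|, |y|)`. -/
def IsLatticeBimorphism {E F G : Type*} [AddCommGroup E] [Module ℝ E] [Lattice E]
    [AddCommGroup F] [Module ℝ F] [Lattice F] [AddCommGroup G] [Module ℝ G] [Lattice G]
    (ψ : E →ₗ[ℝ] F →ₗ[ℝ] G) : Prop :=
  ∀ x y, |ψ x y| = ψ |x| |y|

/-- A lattice bimorphism on `E × F` with values in some Archimedean vector lattice. -/
structure ArchBimorphism (E : Type u) (F : Type v) [AddCommGroup E] [Module ℝ E] [Lattice E]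
    [AddCommGroup F] [Module ℝ F] [Lattice F] where
  /-- the Archimedean vector lattice in which the bimorphism takes its values -/
  G : Type (max u v)
  [addCommGroup : AddCommGroup G]
  [module : Module ℝ G]
  [lattice : Lattice G]
  [isOrderedAddMonoid : IsOrderedAddMonoid G]
  [isOrderedModule : IsOrderedModule ℝ G]
  archimedean : IsArchimedeanLattice G
  /-- the bimorphism -/
  map : E →ₗ[ℝ] F →ₗ[ℝ] G
  isBimorphism : IsLatticeBimorphism map

attribute [instance] ArchBimorphism.addCommGroup ArchBimorphism.module ArchBimorphism.lattice
  ArchBimorphism.isOrderedAddMonoid ArchBimorphism.isOrderedModule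

/-- Formal vector lattice expressions in the symbols `x ⊗ y`. -/
inductive TensorExpr (E : Type u) (F : Type v) : Type (max u v)
  | tmul (x : E) (y : F) : TensorExpr E F
  | zero : TensorExpr E F
  | add (s t : TensorExpr E F) : TensorExpr E F
  | smul (c : ℝ) (s : TensorExpr E F) : TensorExpr E F
  | sup (s t : TensorExpr E F) : TensorExpr E F

section Fremlin

variable {E : Type u} {F : Type v} [AddCommGroup E] [Module ℝ E] [Lattice E]
  [AddCommGroup F] [Module ℝ F] [Lattice F]

/-- The value of a formal expression under a lattice bimorphism. -/
def TensorExpr.eval (R : ArchBimorphism E F) : TensorExpr E F → R.G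
  | .tmul x y => R.map x y
  | .zero => 0
  | .add s t => s.eval R + t.eval R
  | .smul c s => c • s.eval R
  | .sup s t => s.eval R ⊔ t.eval R

variable (E F) in
/-- Two expressions are identified if they agree under all lattice bimorphisms into Archimedean
vector lattices. -/
def TensorExpr.setoid : Setoid (TensorExpr E F) where
  r s t := ∀ R : ArchBimorphism E F, s.eval R = t.eval R
  iseqv := ⟨fun _ _ => rfl, fun h R => (h R).symm, fun h k R => (h R).trans (k R)⟩

variable (E F) in
/-- The (Archimedean) vector lattice tensor product `E ⊗̄ F` of Fremlin: the vector lattice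
generated by the elementary tensors `x ⊗ y`, universal for lattice bimorphisms from `E × F` into
Archimedean vector lattices. (A bimorphism may be corestricted to the vector sublattice that its
values generate, whose cardinality is that of a quotient of `TensorExpr E F`; so the universe
chosen for the targets is no restriction.) -/
def FremlinTensor : Type (max u v) := Quotient (TensorExpr.setoid E F)

namespace FremlinTensor

/-- The class of an expression. -/
def mk (s : TensorExpr E F) : FremlinTensor E F := Quotient.mk (TensorExpr.setoid E F) s

/-- The lattice homomorphism on `E ⊗̄ F` induced by a lattice bimorphism. -/
def eval (R : ArchBimorphism E F) (a : FremlinTensor E F) : R.G :=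
  Quotient.lift (fun s : TensorExpr E F => s.eval R) (fun s t (h : ∀ R, s.eval R = t.eval R) => h R) a

theorem ind {p : FremlinTensor E F → Prop} (h : ∀ s, p (mk s)) (a) : p a := Quotient.ind h a

theorem ext {a b : FremlinTensor E F} (h : ∀ R : ArchBimorphism E F, eval R a = eval R b) :
    a = b := by
  induction a using ind with | h s
  induction b using ind with | h t
  exact Quotient.sound h

/-- The elementary tensor `x ⊗ y`. -/
def tmul (x : E) (y : F) : FremlinTensor E F := mk (.tmul x y)

instance : Zero (FremlinTensor E F) := ⟨mk .zero⟩

instance : Add (FremlinTensor E F) :=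
  ⟨Quotient.map₂ TensorExpr.add fun _ _ h _ _ k R => congrArg₂ (· + ·) (h R) (k R)⟩

instance : SMul ℝ (FremlinTensor E F) :=
  ⟨fun c => Quotient.map (TensorExpr.smul c) fun _ _ h R => congrArg (c • ·) (h R)⟩

instance : Neg (FremlinTensor E F) := ⟨fun a => (-1 : ℝ) • a⟩

/-- The supremum on `E ⊗̄ F`. -/
protected def sup : FremlinTensor E F → FremlinTensor E F → FremlinTensor E F :=
  Quotient.map₂ TensorExpr.sup fun _ _ h _ _ k R => congrArg₂ (· ⊔ ·) (h R) (k R)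

/-- The infimum on `E ⊗̄ F`. -/
protected def inf (a b : FremlinTensor E F) : FremlinTensor E F := -(-a).sup (-b)

variable (R : ArchBimorphism E F) (a b : FremlinTensor E F)

theorem eval_tmul (x : E) (y : F) : eval R (tmul x y) = R.map x y := rfl

theorem eval_zero : eval R 0 = 0 := rfl

theorem eval_add : eval R (a + b) = eval R a + eval R b := by
  induction a using ind; induction b using ind; rfl

theorem eval_smul (c : ℝ) : eval R (c • a) = c • eval R a := by
  induction a using ind; rfl

theorem eval_neg : eval R (-a) = -eval R a :=
  (eval_smul R a (-1)).trans (neg_one_smul ℝ _)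

theorem eval_sup' : eval R (a.sup b) = eval R a ⊔ eval R b := by
  induction a using ind; induction b using ind; rfl

theorem eval_inf' : eval R (a.inf b) = eval R a ⊓ eval R b := by
  rw [FremlinTensor.inf, eval_neg, eval_sup', eval_neg, eval_neg, neg_sup, neg_neg, neg_neg]

instance : AddCommGroup (FremlinTensor E F) where
  add_assoc a b c := ext fun R => by simp only [eval_add, add_assoc]
  zero_add a := ext fun R => by simp only [eval_add, eval_zero, zero_add]
  add_zero a := ext fun R => by simp only [eval_add, eval_zero, add_zero]
  add_comm a b := ext fun R => by simp only [eval_add, add_comm]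
  neg_add_cancel a := ext fun R => by simp only [eval_add, eval_neg, eval_zero, neg_add_cancel]
  nsmul := nsmulRec
  zsmul := zsmulRec

instance : Module ℝ (FremlinTensor E F) where
  one_smul a := ext fun R => by simp only [eval_smul, one_smul]
  mul_smul c d a := ext fun R => by simp only [eval_smul, mul_smul]
  smul_zero c := ext fun R => by simp only [eval_smul, eval_zero, smul_zero]
  smul_add c a b := ext fun R => by simp only [eval_smul, eval_add, smul_add]
  add_smul c d a := ext fun R => by simp only [eval_smul, eval_add, add_smul]
  zero_smul a := ext fun R => by simp only [eval_smul, eval_zero, zero_smul]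

instance : Lattice (FremlinTensor E F) where
  le a b := ∀ R : ArchBimorphism E F, eval R a ≤ eval R b
  le_refl _ _ := le_rfl
  le_trans _ _ _ h k R := (h R).trans (k R)
  le_antisymm _ _ h k := ext fun R => (h R).antisymm (k R)
  sup := FremlinTensor.sup
  le_sup_left a b R := by rw [eval_sup']; exact le_sup_left
  le_sup_right a b R := by rw [eval_sup']; exact le_sup_right
  sup_le a b c h k R := by rw [eval_sup']; exact sup_le (h R) (k R)
  inf := FremlinTensor.inf
  inf_le_left a b R := by rw [eval_inf']; exact inf_le_left
  inf_le_right a b R := by rw [eval_inf']; exact inf_le_right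
  le_inf a b c h k R := by rw [eval_inf']; exact le_inf (h R) (k R)

theorem eval_sup : eval R (a ⊔ b) = eval R a ⊔ eval R b := eval_sup' R a b

theorem eval_inf : eval R (a ⊓ b) = eval R a ⊓ eval R b := eval_inf' R a b

theorem le_iff {a b : FremlinTensor E F} :
    a ≤ b ↔ ∀ R : ArchBimorphism E F, eval R a ≤ eval R b := Iff.rfl

instance : IsOrderedAddMonoid (FremlinTensor E F) where
  add_le_add_left a b h c := le_iff.2 fun R => by
    rw [eval_add, eval_add]; exact add_le_add_left (h R) _

instance : IsOrderedModule ℝ (FremlinTensor E F) where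
  smul_le_smul_of_nonneg_left c hc a b h := le_iff.2 fun R => by
    rw [eval_smul, eval_smul]; exact smul_le_smul_of_nonneg_left (h R) hc
  smul_le_smul_of_nonneg_right a ha c d h := le_iff.2 fun R => by
    rw [eval_smul, eval_smul]; exact smul_le_smul_of_nonneg_right h (ha R)

theorem abs_tmul (x : E) (y : F) : |tmul x y| = tmul |x| |y| :=
  ext fun R => by
    rw [abs, eval_sup, eval_neg]; exact R.isBimorphism x y

theorem smul_tmul (c : ℝ) (x : E) (y : F) : c • tmul x y = tmul (c • x) y :=
  ext fun R => by simp [eval_smul, eval_tmul]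

theorem abs_smul_eq (c : ℝ) : |c • a| = |c| • |a| := by
  have key : ∀ (d : ℝ), 0 ≤ d → ∀ b : FremlinTensor E F, |d • b| ≤ d • |b| := fun d hd b =>
    abs_le'.2 ⟨smul_le_smul_of_nonneg_left (le_abs_self b) hd, by
      rw [← smul_neg]; exact smul_le_smul_of_nonneg_left (neg_le_abs b) hd⟩
  have main : ∀ (d : ℝ), 0 ≤ d → |d • a| = d • |a| := fun d hd => by
    refine (key d hd a).antisymm ?_
    rcases hd.eq_or_lt with rfl | hd
    · simp
    · have h := smul_le_smul_of_nonneg_left (key d⁻¹ (inv_nonneg.2 hd.le) (d • a)) hd.le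
      rwa [smul_smul, smul_smul, inv_mul_cancel₀ hd.ne', mul_inv_cancel₀ hd.ne', one_smul,
        one_smul] at h
  rcases le_total 0 c with hc | hc
  · rw [main c hc, abs_of_nonneg hc]
  · rw [abs_of_nonpos hc, ← main (-c) (neg_nonneg.2 hc), neg_smul, abs_neg]

end FremlinTensor

end Fremlin

/-! ### The positive projective norm and the completion -/

section Norm

namespace FremlinTensor

variable {E : Type u} {F : Type v} [NormedAddCommGroup E] [NormedSpace ℝ E] [Lattice E]
  [NormedAddCommGroup F] [NormedSpace ℝ F] [Lattice F]

/-- The numbers `∑ ‖x_k‖ ‖y_k‖` with `x_k ∈ E⁺`, `y_k ∈ F⁺` and `|w| ≤ ∑ x_k ⊗ y_k`. -/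
def dominatingSums (w : FremlinTensor E F) : Set ℝ :=
  {r | ∃ (n : ℕ) (x : Fin n → E) (y : Fin n → F), (∀ k, 0 ≤ x k) ∧ (∀ k, 0 ≤ y k) ∧
    |w| ≤ ∑ k, tmul (x k) (y k) ∧ r = ∑ k, ‖x k‖ * ‖y k‖}

/-- The positive projective norm `‖w‖_{|π|}`. -/
def projNorm (w : FremlinTensor E F) : ℝ := sInf (dominatingSums w)

theorem dominatingSums_nonneg {w : FremlinTensor E F} {r : ℝ} (h : r ∈ dominatingSums w) :
    0 ≤ r := by
  obtain ⟨n, x, y, -, -, -, rfl⟩ := h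
  positivity

theorem bddBelow_dominatingSums (w : FremlinTensor E F) : BddBelow (dominatingSums w) :=
  ⟨0, fun _ h => dominatingSums_nonneg h⟩

theorem dominatingSums_mono {w z : FremlinTensor E F} (h : |w| ≤ |z|) {r : ℝ}
    (hr : r ∈ dominatingSums z) : r ∈ dominatingSums w := by
  obtain ⟨n, x, y, hx, hy, hz, rfl⟩ := hr
  exact ⟨n, x, y, hx, hy, h.trans hz, rfl⟩

theorem dominatingSums_add {w z : FremlinTensor E F} {r s : ℝ} (hr : r ∈ dominatingSums w)
    (hs : s ∈ dominatingSums z) {q : FremlinTensor E F} (hq : |q| ≤ |w| + |z|) :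
    r + s ∈ dominatingSums q := by
  obtain ⟨n, x, y, hx, hy, hw, rfl⟩ := hr
  obtain ⟨m, x', y', hx', hy', hz, rfl⟩ := hs
  refine ⟨n + m, Fin.append x x', Fin.append y y', ?_, ?_, ?_, ?_⟩
  · intro k; induction k using Fin.addCases <;> simp [*]
  · intro k; induction k using Fin.addCases <;> simp [*]
  · rw [Fin.sum_univ_add]; simpa using hq.trans (add_le_add hw hz)
  · rw [Fin.sum_univ_add]; simp

theorem dominatingSums_smul {w : FremlinTensor E F} {r : ℝ} (hE : ∀ c : ℝ, 0 ≤ c → ∀ x : E,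
    0 ≤ x → 0 ≤ c • x) (hr : r ∈ dominatingSums w) (c : ℝ) :
    |c| * r ∈ dominatingSums (c • w) := by
  obtain ⟨n, x, y, hx, hy, hw, rfl⟩ := hr
  refine ⟨n, fun k => |c| • x k, y, fun k => hE _ (abs_nonneg c) _ (hx k), hy, ?_, ?_⟩
  · rw [abs_smul_eq]
    refine (smul_le_smul_of_nonneg_left hw (abs_nonneg c)).trans_eq ?_
    simp only [Finset.smul_sum, smul_tmul]
  · simp [Finset.mul_sum, norm_smul, mul_assoc]

end FremlinTensor

end Norm

section BanachLattice

variable {E : Type u} {F : Type v} [NormedAddCommGroup E] [NormedSpace ℝ E] [Lattice E]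
  [IsOrderedAddMonoid E] [IsOrderedModule ℝ E] [HasSolidNorm E]
  [NormedAddCommGroup F] [NormedSpace ℝ F] [Lattice F]
  [IsOrderedAddMonoid F] [IsOrderedModule ℝ F] [HasSolidNorm F]

namespace FremlinTensor

theorem dominatingSums_nonempty (w : FremlinTensor E F) : (dominatingSums w).Nonempty := by
  induction w using ind with | h s
  induction s with
  | tmul x y =>
    exact ⟨_, 1, fun _ => |x|, fun _ => |y|, fun _ => abs_nonneg x, fun _ => abs_nonneg y,
      (abs_tmul x y).le.trans (by simp), rfl⟩
  | zero => exact ⟨0, 0, Fin.elim0, Fin.elim0, by simp, by simp, by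
      change |(0 : FremlinTensor E F)| ≤ _; simp, by simp⟩
  | add s t hs ht =>
    exact ⟨_, dominatingSums_add hs.some_mem ht.some_mem (abs_add_le (mk s) (mk t))⟩
  | smul c s hs =>
    exact ⟨_, dominatingSums_smul (fun _ hc _ hx => smul_nonneg hc hx) hs.some_mem c⟩
  | sup s t hs ht =>
    refine ⟨_, dominatingSums_add hs.some_mem ht.some_mem
      (q := mk s ⊔ mk t) (abs_le'.2 ⟨?_, ?_⟩)⟩
    · exact sup_le ((le_abs_self _).trans (le_add_of_nonneg_right (abs_nonneg _)))
        ((le_abs_self _).trans (le_add_of_nonneg_left (abs_nonneg _)))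
    · exact (neg_le_neg le_sup_left).trans
        ((neg_le_abs _).trans (le_add_of_nonneg_right (abs_nonneg _)))

theorem projNorm_solid {w z : FremlinTensor E F} (h : |w| ≤ |z|) : projNorm w ≤ projNorm z :=
  csInf_le_csInf (bddBelow_dominatingSums w) (dominatingSums_nonempty z)
    fun _ => dominatingSums_mono h

theorem projNorm_nonneg (w : FremlinTensor E F) : 0 ≤ projNorm w :=
  Real.sInf_nonneg fun _ h => dominatingSums_nonneg h

theorem projNorm_add_le (w z : FremlinTensor E F) : projNorm (w + z) ≤ projNorm w + projNorm z := by
  refine le_of_forall_pos_le_add fun ε hε => ?_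
  obtain ⟨r, hr, hr'⟩ := exists_lt_of_csInf_lt (dominatingSums_nonempty w)
    (lt_add_of_pos_right (projNorm w) (half_pos hε))
  obtain ⟨s, hs, hs'⟩ := exists_lt_of_csInf_lt (dominatingSums_nonempty z)
    (lt_add_of_pos_right (projNorm z) (half_pos hε))
  have : projNorm (w + z) ≤ r + s :=
    csInf_le (bddBelow_dominatingSums _) (dominatingSums_add hr hs (abs_add_le w z))
  linarith

theorem projNorm_smul_le (c : ℝ) (w : FremlinTensor E F) :
    projNorm (c • w) ≤ |c| * projNorm w := by
  rw [projNorm, projNorm, ← smul_eq_mul, ← Real.sInf_smul_of_nonneg (abs_nonneg c)]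
  refine csInf_le_csInf (bddBelow_dominatingSums _) ((dominatingSums_nonempty w).smul_set) ?_
  rintro _ ⟨r, hr, rfl⟩
  exact dominatingSums_smul (fun _ hc _ hx => smul_nonneg hc hx) hr c

/-- `‖·‖_{|π|}` is registered as a seminorm: that it vanishes only at `0` is a theorem which
is not needed to form the completion. -/
instance : SeminormedAddCommGroup (FremlinTensor E F) :=
  AddGroupSeminorm.toSeminormedAddCommGroup
    { toFun := projNorm
      map_zero' := (projNorm_nonneg _).antisymm' (by simpa using projNorm_smul_le 0 (0 : FremlinTensor E F))
      add_le' := projNorm_add_le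
      neg' := fun w => by
        refine le_antisymm ?_ ?_ <;> exact projNorm_solid (by simp) }

theorem norm_def (w : FremlinTensor E F) : ‖w‖ = projNorm w := rfl

instance : NormedSpace ℝ (FremlinTensor E F) where
  norm_smul_le := projNorm_smul_le

theorem norm_solid {w z : FremlinTensor E F} (h : |w| ≤ |z|) : ‖w‖ ≤ ‖z‖ := projNorm_solid h

theorem norm_sup_sub_sup_le (a b c d : FremlinTensor E F) :
    ‖a ⊔ b - c ⊔ d‖ ≤ ‖a - c‖ + ‖b - d‖ := by
  refine (norm_solid ?_).trans ((norm_add_le |a - c| |b - d|).trans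
    (add_le_add (norm_solid (abs_abs _).le) (norm_solid (abs_abs _).le)))
  rw [abs_of_nonneg (add_nonneg (abs_nonneg (a - c)) (abs_nonneg (b - d)))]
  calc |a ⊔ b - c ⊔ d| = |a ⊔ b - c ⊔ b + (c ⊔ b - c ⊔ d)| := by rw [sub_add_sub_cancel]
    _ ≤ |a ⊔ b - c ⊔ b| + |c ⊔ b - c ⊔ d| := abs_add_le _ _
    _ ≤ |a - c| + |b - d| := by
      refine add_le_add (abs_sup_sub_sup_le_abs _ _ _) ?_
      rw [sup_comm c, sup_comm c]
      exact abs_sup_sub_sup_le_abs _ _ _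

theorem uniformContinuous_sup :
    UniformContinuous₂ fun a b : FremlinTensor E F => a ⊔ b := by
  refine Metric.uniformContinuous_iff.2 fun ε hε => ⟨ε / 2, half_pos hε, ?_⟩
  rintro ⟨a, b⟩ ⟨c, d⟩ h
  rw [Prod.dist_eq, max_lt_iff, dist_eq_norm, dist_eq_norm] at h
  have := norm_sup_sub_sup_le a b c d
  change dist (a ⊔ b) (c ⊔ d) < ε
  rw [dist_eq_norm]
  linarith [h.1, h.2]

end FremlinTensor

variable (E F) in
/-- The positive projective tensor product of the Banach lattices `E` and `F`: the completion of
the vector lattice tensor product under the positive projective norm. -/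
def PosProjTensor : Type (max u v) := Completion (FremlinTensor E F)

namespace PosProjTensor

instance : NormedAddCommGroup (PosProjTensor E F) :=
  inferInstanceAs (NormedAddCommGroup (Completion (FremlinTensor E F)))

instance : NormedSpace ℝ (PosProjTensor E F) :=
  inferInstanceAs (NormedSpace ℝ (Completion (FremlinTensor E F)))

instance : CompleteSpace (PosProjTensor E F) :=
  inferInstanceAs (CompleteSpace (Completion (FremlinTensor E F)))

/-- The canonical linear isometry into the completion. -/
def of : FremlinTensor E F →ₗᵢ[ℝ] PosProjTensor E F :=
  (Completion.toComplₗᵢ : FremlinTensor E F →ₗᵢ[ℝ] Completion (FremlinTensor E F))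

/-- The supremum, extended from `E ⊗̄ F` by continuity. -/
protected def sup : PosProjTensor E F → PosProjTensor E F → PosProjTensor E F :=
  Completion.map₂ fun a b : FremlinTensor E F => a ⊔ b

/-- The infimum. -/
protected def inf (a b : PosProjTensor E F) : PosProjTensor E F := -(-a).sup (-b)

theorem sup_of (a b : FremlinTensor E F) : (of a).sup (of b) = of (a ⊔ b) :=
  Completion.map₂_coe_coe a b _ FremlinTensor.uniformContinuous_sup

theorem inf_of (a b : FremlinTensor E F) : (of a).inf (of b) = of (a ⊓ b) := by
  rw [PosProjTensor.inf, ← map_neg, ← map_neg, sup_of, ← map_neg, neg_sup, neg_neg, neg_neg]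

theorem continuous_sup {X : Type*} [TopologicalSpace X] {f g : X → PosProjTensor E F}
    (hf : Continuous f) (hg : Continuous g) : Continuous fun x => (f x).sup (g x) :=
  Completion.continuous_map₂ hf hg

theorem continuous_inf {X : Type*} [TopologicalSpace X] {f g : X → PosProjTensor E F}
    (hf : Continuous f) (hg : Continuous g) : Continuous fun x => (f x).inf (g x) :=
  (continuous_sup hf.neg hg.neg).neg

theorem denseRange_of : DenseRange (of : FremlinTensor E F → PosProjTensor E F) :=
  Completion.denseRange_coe

theorem ind₁ {p : PosProjTensor E F → Prop} (hp : IsClosed {a | p a})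
    (h : ∀ a, p (of a)) (a) : p a :=
  denseRange_of.induction_on a hp h

theorem ind₂ {p : PosProjTensor E F → PosProjTensor E F → Prop}
    (hp : IsClosed {q : PosProjTensor E F × PosProjTensor E F | p q.1 q.2})
    (h : ∀ a b, p (of a) (of b)) (a b) : p a b :=
  denseRange_of.induction_on₂ hp h a b

theorem ind₃ {p : PosProjTensor E F → PosProjTensor E F → PosProjTensor E F → Prop}
    (hp : IsClosed {q : PosProjTensor E F × PosProjTensor E F × PosProjTensor E F |
      p q.1 q.2.1 q.2.2})
    (h : ∀ a b c, p (of a) (of b) (of c)) (a b c) : p a b c :=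
  denseRange_of.induction_on₃ hp h a b c

/-- The Banach lattice order of `PosProjTensor E F`: `a ≤ b` means `a ⊔ b = b`. -/
instance : Lattice (PosProjTensor E F) :=
  @Lattice.mk' _ ⟨PosProjTensor.sup⟩ ⟨PosProjTensor.inf⟩
    (ind₂ (isClosed_eq (continuous_sup continuous_fst continuous_snd)
      (continuous_sup continuous_snd continuous_fst)) fun a b => by
        change (of a).sup (of b) = (of b).sup (of a)
        rw [sup_of, sup_of, sup_comm])
    (ind₃ (isClosed_eq
      (continuous_sup (continuous_sup continuous_fst (continuous_fst.comp continuous_snd))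
        (continuous_snd.comp continuous_snd))
      (continuous_sup continuous_fst (continuous_sup (continuous_fst.comp continuous_snd)
        (continuous_snd.comp continuous_snd)))) fun a b c => by
        change ((of a).sup (of b)).sup (of c) = (of a).sup ((of b).sup (of c))
        rw [sup_of, sup_of, sup_of, sup_of, sup_assoc])
    (ind₂ (isClosed_eq (continuous_inf continuous_fst continuous_snd)
      (continuous_inf continuous_snd continuous_fst)) fun a b => by
        change (of a).inf (of b) = (of b).inf (of a)
        rw [inf_of, inf_of, inf_comm])
    (ind₃ (isClosed_eq
      (continuous_inf (continuous_inf continuous_fst (continuous_fst.comp continuous_snd))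
        (continuous_snd.comp continuous_snd))
      (continuous_inf continuous_fst (continuous_inf (continuous_fst.comp continuous_snd)
        (continuous_snd.comp continuous_snd)))) fun a b c => by
        change ((of a).inf (of b)).inf (of c) = (of a).inf ((of b).inf (of c))
        rw [inf_of, inf_of, inf_of, inf_of, inf_assoc])
    (ind₂ (isClosed_eq (continuous_sup continuous_fst
      (continuous_inf continuous_fst continuous_snd)) continuous_fst) fun a b => by
        change (of a).sup ((of a).inf (of b)) = of a
        rw [inf_of, sup_of, sup_inf_self])
    (ind₂ (isClosed_eq (continuous_inf continuous_fst
      (continuous_sup continuous_fst continuous_snd)) continuous_fst) fun a b => by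
        change (of a).inf ((of a).sup (of b)) = of a
        rw [sup_of, inf_of, inf_sup_self])

theorem of_sup (a b : FremlinTensor E F) : of (a ⊔ b) = of a ⊔ of b := (sup_of a b).symm

theorem of_abs (a : FremlinTensor E F) : of |a| = |of a| := by
  rw [abs, abs, of_sup, map_neg]

theorem le_iff {a b : PosProjTensor E F} : a ≤ b ↔ a.sup b = b := (sup_eq_right (a := a)).symm

instance : IsOrderedAddMonoid (PosProjTensor E F) where
  add_le_add_left a b h c := by
    have key : ∀ a b c : PosProjTensor E F, (a + c).sup (b + c) = a.sup b + c :=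
      ind₃ (isClosed_eq
        (continuous_sup (by fun_prop) (by fun_prop))
        ((continuous_sup continuous_fst (by fun_prop)).add (by fun_prop))) fun a b c => by
          rw [← map_add, ← map_add, sup_of, sup_of, ← map_add, sup_add]
    rw [le_iff] at h ⊢
    rw [key, h]

instance : IsOrderedModule ℝ (PosProjTensor E F) :=
  have pos : ∀ (c : ℝ), 0 ≤ c → ∀ a : PosProjTensor E F, 0 ≤ a → 0 ≤ c • a := by
    intro c hc a ha
    have key : ∀ a : PosProjTensor E F, (0 : PosProjTensor E F).sup (c • (0 : PosProjTensor E F).sup a)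
        = c • (0 : PosProjTensor E F).sup a := by
      refine ind₁ (isClosed_eq
        (continuous_sup continuous_const
          ((continuous_sup continuous_const continuous_id).const_smul c))
        ((continuous_sup continuous_const continuous_id).const_smul c)) fun a => ?_
      rw [← map_zero (of : FremlinTensor E F →ₗᵢ[ℝ] PosProjTensor E F), sup_of, ← map_smul, sup_of,
        sup_eq_right.2 (smul_nonneg hc le_sup_left)]
    have h := key a
    rw [le_iff.1 ha] at h
    exact le_iff.2 h
  { smul_le_smul_of_nonneg_left := fun c hc a b h => by
      simpa [smul_sub] using pos c hc (b - a) (sub_nonneg.2 h)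
    smul_le_smul_of_nonneg_right := fun a ha c d h => by
      simpa [sub_smul] using pos (d - c) (sub_nonneg.2 h) a ha }

instance : HasSolidNorm (PosProjTensor E F) where
  solid x y h := by
    have hn : ∀ x : PosProjTensor E F, ‖x.sup (-x)‖ = ‖x‖ :=
      ind₁ (isClosed_eq (continuous_sup continuous_id continuous_neg).norm continuous_norm)
        fun a => by
          rw [← map_neg, sup_of, LinearIsometry.norm_map, LinearIsometry.norm_map]
          exact le_antisymm (FremlinTensor.norm_solid (abs_abs a).le)
            (FremlinTensor.norm_solid (abs_abs a).ge)
    have hle : ∀ x y : PosProjTensor E F, ‖(x.sup (-x)).inf (y.sup (-y))‖ ≤ ‖y‖ :=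
      ind₂ (isClosed_le
        (continuous_inf (continuous_sup continuous_fst continuous_fst.neg)
          (continuous_sup continuous_snd continuous_snd.neg)).norm continuous_snd.norm)
        fun a b => by
          rw [← map_neg, ← map_neg, sup_of, sup_of, inf_of, LinearIsometry.norm_map,
            LinearIsometry.norm_map]
          refine FremlinTensor.norm_solid ?_
          change |(|a| ⊓ |b|)| ≤ |b|
          rw [abs_of_nonneg (le_inf (abs_nonneg a) (abs_nonneg b))]
          exact inf_le_right
    have e : (x.sup (-x)).inf (y.sup (-y)) = x.sup (-x) := inf_eq_left.2 h
    rw [← hn x, ← e]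
    exact hle x y

end PosProjTensor

end BanachLattice

end

/-! A positive functional φ on the tensor product and a positive weak*-weak* continuous operator
`F** → E*` both give a positive operator `T : F** → E*` of the form `T y x = y (r x)` with `r : E →
F*`. Statements 2 and 3 therefore follow from 1 by one argument, `tendsto_norm_zero_of_hasPSP`. If
`T n` is null for the weak operator topology, the PSP of `E*` upgrades this to `‖T n y‖ → 0` for
each `y ≥ 0`, hence for each `y`, since functionals on `E*` are differences of positive ones. Now
choose positive `x n` in the unit ball at which `r n` nearly attains its norm. The positive
functionals `r n (x n)` are weakly null because `|y (r n (x n))| ≤ ‖T n y‖`, and the PSP of `F*`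
makes them norm null. For 3, the bound `‖φ‖ ≤ ‖T‖` suffices; the dual of the tensor product need not
be identified with a space of operators.

Conversely, a positive weakly null sequence in `E*` or `F*` is multiplied by a fixed nonzero
positive functional on the other factor. In 2 this gives rank one operators. In 3 it requires a
positive functional `f ⊗ g` on the tensor product, although `(x, y) ↦ f x * g y` is in general no
lattice bimorphism, so that the universal property does not apply to it directly. The remedy is to
split `f` into finitely many positive pieces that act as lattice homomorphisms at finitely many
given points (`exists_partition`). The maps `(x, y) ↦ (h k x • y)` are then bimorphisms at these
points, and an ultralimit over finite subsets of `E`, taken modulo the null ideal of the limit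
functional, is a genuine bimorphism into an Archimedean vector lattice. The functionals so obtained
are weakly null by a convexity argument (`tendsto_zero_of_norm_sum_le`). -/

noncomputable section

universe u v

set_option linter.unusedSectionVars false

/-! ### Real scalars in vector lattices -/

section VectorLattice

variable {E : Type*} [AddCommGroup E] [Module ℝ E] [Lattice E] [IsOrderedAddMonoid E]
  [IsOrderedModule ℝ E]

theorem smul_posPart_of_nonneg {c : ℝ} (hc : 0 ≤ c) (x : E) : (c • x)⁺ = c • x⁺ := by
  have key : ∀ (d : ℝ), 0 ≤ d → ∀ y : E, (d • y)⁺ ≤ d • y⁺ := fun d hd y =>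
    sup_le (smul_le_smul_of_nonneg_left le_sup_left hd) (smul_nonneg hd (posPart_nonneg y))
  refine (key c hc x).antisymm ?_
  rcases hc.eq_or_lt with rfl | hc'
  · simp
  · have h := smul_le_smul_of_nonneg_left (key c⁻¹ (inv_nonneg.2 hc) (c • x)) hc
    rwa [smul_smul, smul_smul, inv_mul_cancel₀ hc'.ne', mul_inv_cancel₀ hc'.ne', one_smul,
      one_smul] at h

theorem abs_real_smul (c : ℝ) (x : E) : |c • x| = |c| • |x| := by
  have main : ∀ d : ℝ, 0 ≤ d → |d • x| = d • |x| := fun d hd => by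
    rw [← posPart_add_negPart, ← posPart_add_negPart, smul_posPart_of_nonneg hd, negPart_def,
      negPart_def, ← smul_neg, ← posPart_def, smul_posPart_of_nonneg hd, smul_add, posPart_def (-x)]
  rcases le_total 0 c with hc | hc
  · rw [main c hc, abs_of_nonneg hc]
  · rw [abs_of_nonpos hc, ← main (-c) (neg_nonneg.2 hc), neg_smul, abs_neg]

end VectorLattice

/-! ### Sublinear functionals and positive functionals -/

section Decomposition

variable {X : Type*} [NormedAddCommGroup X] [NormedSpace ℝ X] [Preorder X]

/-- If the norm of an ordered normed space is monotone on the positive cone, then every continuous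
functional is a difference of two positive ones (Krein). -/
theorem StrongDual.exists_nonneg_sub (hadd : ∀ x y : X, 0 ≤ x → 0 ≤ y → 0 ≤ x + y)
    (hsmul : ∀ c : ℝ, 0 < c → ∀ x : X, 0 ≤ x → 0 ≤ c • x)
    (hmono : ∀ x y : X, 0 ≤ x → 0 ≤ y → ‖y‖ ≤ ‖x + y‖) (g : StrongDual ℝ X) :
    ∃ p q : StrongDual ℝ X, 0 ≤ p ∧ 0 ≤ q ∧ g = p - q := by
  -- `N` is built so that a linear `P ≤ N` is positive, dominates `g` on the cone and is bounded by
  -- `‖g‖`: the vector `c` enforces `P ≥ 0`, the vector `d` enforces `P ≥ g`, and `c = d = 0` gives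
  -- the norm bound.
  let S : X → Set ℝ := fun x =>
    {r | ∃ c d : X, 0 ≤ c ∧ 0 ≤ d ∧ r = ‖g‖ * ‖x + c + d‖ - g d}
  let N : X → ℝ := fun x => sInf (S x)
  -- Finiteness of `N` is where monotonicity of the norm enters: it bounds `‖d‖` by `‖c + d‖`, hence
  -- `g d` in terms of `x + c + d` and `x`.
  have hlow : ∀ x, ∀ r ∈ S x, -(‖g‖ * ‖x‖) ≤ r := by
    rintro x _ ⟨c, d, hc, hd, rfl⟩
    have h1 : g d ≤ ‖g‖ * ‖d‖ := (le_abs_self _).trans (g.le_opNorm d)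
    have h2 : ‖d‖ ≤ ‖x + c + d‖ + ‖x‖ := by
      refine (hmono c d hc hd).trans ?_
      have : c + d = (x + c + d) - x := by abel
      rw [this]
      exact norm_sub_le _ _
    nlinarith [norm_nonneg g, mul_le_mul_of_nonneg_left h2 (norm_nonneg g)]
  have hbdd : ∀ x, BddBelow (S x) := fun x => ⟨_, fun r hr => hlow x r hr⟩
  have hmem : ∀ x c d : X, 0 ≤ c → 0 ≤ d → N x ≤ ‖g‖ * ‖x + c + d‖ - g d :=
    fun x c d hc hd => csInf_le (hbdd x) ⟨c, d, hc, hd, rfl⟩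
  have hne : ∀ x, (S x).Nonempty := fun x => ⟨_, 0, 0, le_rfl, le_rfl, rfl⟩
  have hhom' : ∀ c : ℝ, 0 < c → ∀ x, N (c • x) ≤ c * N x := by
    intro c hc x
    rw [← div_le_iff₀' hc]
    refine le_csInf (hne x) ?_
    rintro _ ⟨a, b, ha, hb, rfl⟩
    rw [div_le_iff₀' hc]
    refine (hmem (c • x) (c • a) (c • b) (hsmul c hc a ha) (hsmul c hc b hb)).trans_eq ?_
    rw [← smul_add, ← smul_add, norm_smul, map_smul, smul_eq_mul, Real.norm_of_nonneg hc.le]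
    ring
  -- Only the existence of some linear functional below `N` is wanted, so the extension starts from
  -- the zero subspace.
  obtain ⟨P, -, hP⟩ := exists_extension_of_le_sublinear (⟨⊥, 0⟩ : X →ₗ.[ℝ] ℝ) N
    (fun c hc x => by
      refine (hhom' c hc x).antisymm ?_
      have := hhom' c⁻¹ (inv_pos.2 hc) (c • x)
      rw [smul_smul, inv_mul_cancel₀ hc.ne', one_smul] at this
      calc c * N x ≤ c * (c⁻¹ * N (c • x)) := mul_le_mul_of_nonneg_left this hc.le
        _ = N (c • x) := by field_simp)
    (fun x y => by
      refine le_of_forall_pos_le_add fun ε hε => ?_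
      obtain ⟨_, ⟨a, b, ha, hb, rfl⟩, h1⟩ :=
        exists_lt_of_csInf_lt (hne x) (lt_add_of_pos_right (N x) (half_pos hε))
      obtain ⟨_, ⟨a', b', ha', hb', rfl⟩, h2⟩ :=
        exists_lt_of_csInf_lt (hne y) (lt_add_of_pos_right (N y) (half_pos hε))
      have h3 := hmem (x + y) (a + a') (b + b') (hadd _ _ ha ha') (hadd _ _ hb hb')
      have h4 : ‖x + y + (a + a') + (b + b')‖ ≤ ‖x + a + b‖ + ‖y + a' + b'‖ := by
        refine le_of_eq_of_le ?_ (norm_add_le _ _)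
        congr 1; abel
      rw [map_add] at h3
      nlinarith [mul_le_mul_of_nonneg_left h4 (norm_nonneg g)])
    (fun x => by
      have hx : (x : X) = 0 := (Submodule.mem_bot ℝ).1 x.2
      rw [hx]
      refine le_csInf (hne 0) fun r hr => ?_
      simpa using hlow 0 r hr)
  have hPn : ∀ x, P x ≤ ‖g‖ * ‖x‖ := fun x =>
    (hP x).trans ((hmem x 0 0 le_rfl le_rfl).trans_eq (by simp))
  let p : StrongDual ℝ X := P.mkContinuous ‖g‖ fun x => by
    refine abs_le'.2 ⟨hPn x, ?_⟩
    have := hPn (-x)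
    rwa [map_neg, norm_neg] at this
  have hp : ∀ x, p x = P x := fun x => rfl
  -- For `x ≥ 0`, both inequalities come from `P (-x) ≤ N (-x)`, with `(c, d) = (x, 0)` and `(c, d)
  -- = (0, x)`; the norm term vanishes in each case.
  refine ⟨p, p - g, fun x hx => ?_, fun x hx => ?_, by abel⟩
  · have := (hP (-x)).trans (hmem (-x) x 0 hx le_rfl)
    simp at this
    simpa [hp] using this
  · have := (hP (-x)).trans (hmem (-x) 0 x le_rfl hx)
    simp at this
    simpa [hp] using this

end Decomposition

/-! ### Positive functionals on a Banach lattice and their components -/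

section BanachLatticeDual

variable {E : Type*} [NormedAddCommGroup E] [NormedSpace ℝ E] [Lattice E]
  [IsOrderedAddMonoid E] [IsOrderedModule ℝ E] [HasSolidNorm E]

theorem norm_le_norm_of_nonneg_of_le {x y : E} (hx : 0 ≤ x) (hxy : x ≤ y) : ‖x‖ ≤ ‖y‖ :=
  HasSolidNorm.solid (by rwa [abs_of_nonneg hx, abs_of_nonneg (hx.trans hxy)])

theorem norm_posPart_le_norm (x : E) : ‖x⁺‖ ≤ ‖x‖ :=
  HasSolidNorm.solid (by
    rw [abs_of_nonneg (posPart_nonneg x), ← posPart_add_negPart]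
    exact le_add_of_nonneg_right (negPart_nonneg x))

theorem norm_negPart_le_norm (x : E) : ‖x⁻‖ ≤ ‖x‖ :=
  HasSolidNorm.solid (by
    rw [abs_of_nonneg (negPart_nonneg x), ← posPart_add_negPart x]
    exact le_add_of_nonneg_left (posPart_nonneg x))

namespace StrongDual

theorem mono_of_nonneg {f : StrongDual ℝ E} (hf : 0 ≤ f) {x y : E} (h : x ≤ y) : f x ≤ f y := by
  simpa using hf (y - x) (sub_nonneg.2 h)

theorem abs_apply_le_of_nonneg {f : StrongDual ℝ E} (hf : 0 ≤ f) (x : E) : |f x| ≤ f |x| :=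
  abs_le'.2 ⟨mono_of_nonneg hf (le_abs_self x), by
    rw [← map_neg]; exact mono_of_nonneg hf (neg_le_abs x)⟩

theorem norm_le_norm_add {f g : StrongDual ℝ E} (hf : 0 ≤ f) (hg : 0 ≤ g) : ‖g‖ ≤ ‖f + g‖ :=
  g.opNorm_le_bound (norm_nonneg _) fun x => by
    calc ‖g x‖ ≤ g |x| := abs_apply_le_of_nonneg hg x
      _ ≤ (f + g) |x| := le_add_of_nonneg_left (hf _ (abs_nonneg x))
      _ ≤ ‖(f + g) |x|‖ := le_abs_self _
      _ ≤ ‖f + g‖ * ‖|x|‖ := (f + g).le_opNorm _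
      _ = ‖f + g‖ * ‖x‖ := by rw [norm_abs_eq_norm]

theorem exists_nonneg_sub_of_lattice (g : StrongDual ℝ E) :
    ∃ p q : StrongDual ℝ E, 0 ≤ p ∧ 0 ≤ q ∧ g = p - q :=
  exists_nonneg_sub (fun _ _ => add_nonneg) (fun _ hc _ hx => smul_nonneg hc.le hx)
    (fun _ _ hx hy => norm_le_norm_of_nonneg_of_le hy (le_add_of_nonneg_left hx)) g

/-- Monotonicity of the norm on the positive cone of `E*` is enough, so no lattice operations on
`E*` are needed. -/
theorem exists_nonneg_sub_bidual (g : StrongDual ℝ (StrongDual ℝ E)) :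
    ∃ p q : StrongDual ℝ (StrongDual ℝ E), 0 ≤ p ∧ 0 ≤ q ∧ g = p - q :=
  exists_nonneg_sub
    (fun _ _ hf hg x hx => add_nonneg (dual_nonneg_iff.1 hf x hx) (dual_nonneg_iff.1 hg x hx))
    (fun _ hc _ hf x hx => mul_nonneg hc.le (dual_nonneg_iff.1 hf x hx)) (fun _ _ => norm_le_norm_add) g

/-- A nonzero Banach lattice has a positive functional that is nonzero at some positive element. -/
theorem exists_nonneg_pos (E : Type*) [NormedAddCommGroup E] [NormedSpace ℝ E] [Lattice E]
    [IsOrderedAddMonoid E] [IsOrderedModule ℝ E] [HasSolidNorm E] [Nontrivial E] :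
    ∃ f : StrongDual ℝ E, 0 ≤ f ∧ ∃ x : E, 0 ≤ x ∧ 0 < f x := by
  obtain ⟨x, hx⟩ := exists_ne (0 : E)
  obtain ⟨g, -, hg⟩ := exists_dual_vector ℝ x (norm_ne_zero_iff.2 hx)
  obtain ⟨p, q, hp, hq, rfl⟩ := exists_nonneg_sub_of_lattice g
  by_contra! h
  have zero : ∀ f : StrongDual ℝ E, 0 ≤ f → f x = 0 := fun f hf =>
    abs_nonpos_iff.1 ((abs_apply_le_of_nonneg hf x).trans (h f hf _ (abs_nonneg x)))
  have : (p - q) x = 0 := by simp [zero p hp, zero q hq]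
  rw [hg] at this
  exact hx (norm_eq_zero.1 (by simpa using this))

/-- A positive functional has a component that agrees with it at `x⁺` and vanishes at `x⁻`. -/
theorem exists_component {f : StrongDual ℝ E} (hf : 0 ≤ f) (x : E) :
    ∃ g : StrongDual ℝ E, 0 ≤ g ∧ g ≤ f ∧ g x = f x⁺ := by
  rcases eq_or_ne x 0 with rfl | hx
  · exact ⟨f, hf, le_rfl, by simp⟩
  -- Hahn–Banach extension of `c • x ↦ c * f x⁺` below the sublinear map `z ↦ f z⁺`. For `z ≥ 0`,
  -- this majorant is `0` at `-z` and `f z` at `z`, which puts the extension between `0` and `f`.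
  obtain ⟨P, hPx, hP⟩ := exists_extension_of_le_sublinear
    (LinearPMap.mkSpanSingleton (σ := RingHom.id ℝ) x (f x⁺) hx) (fun z => f z⁺)
    (fun c hc z => by simp [smul_posPart_of_nonneg hc.le])
    (fun y z => by
      rw [← map_add]
      refine mono_of_nonneg hf (sup_le (add_le_add le_sup_left le_sup_left) ?_)
      exact add_nonneg (posPart_nonneg y) (posPart_nonneg z))
    (by
      rintro ⟨z, hz⟩
      obtain ⟨c, rfl⟩ := Submodule.mem_span_singleton.1 hz
      rw [LinearPMap.mkSpanSingleton'_apply]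
      rcases le_total 0 c with hc | hc
      · simp [smul_posPart_of_nonneg hc]
      · exact (mul_nonpos_of_nonpos_of_nonneg hc (hf _ (posPart_nonneg x))).trans
          (hf _ (posPart_nonneg _)))
  have hPf : ∀ z, P z ≤ ‖f‖ * ‖z‖ := fun z =>
    (hP z).trans ((le_abs_self _).trans ((f.le_opNorm _).trans
      (mul_le_mul_of_nonneg_left (norm_posPart_le_norm z) (norm_nonneg f))))
  refine ⟨P.mkContinuous ‖f‖ fun z => abs_le'.2 ⟨hPf z, ?_⟩, fun z hz => ?_, fun z hz => ?_, ?_⟩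
  · have := hPf (-z)
    rwa [map_neg, norm_neg] at this
  · have := hP (-z)
    rw [posPart_eq_zero.2 (neg_nonpos.2 hz)] at this
    simpa using this
  · have := hP z
    rwa [posPart_eq_self.2 hz] at this
  · exact (hPx ⟨x, Submodule.mem_span_singleton_self x⟩).trans
      (LinearPMap.mkSpanSingleton_apply ℝ ℝ hx (f x⁺))

/-- A positive functional splits into finitely many positive functionals which behave like lattice
homomorphisms at finitely many given points. -/
theorem exists_partition {f : StrongDual ℝ E} (hf : 0 ≤ f) (A : Finset E) :
    ∃ (ι : Type) (_ : Fintype ι) (h : ι → StrongDual ℝ E), (∀ k, 0 ≤ h k) ∧ ∑ k, h k = f ∧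
      ∀ x ∈ A, ∀ k, |h k x| = h k |x| := by
  classical
  induction A using Finset.induction with
  | empty => exact ⟨Unit, inferInstance, fun _ => f, fun _ => hf, by simp, by simp⟩
  | insert x A _ ih =>
    obtain ⟨ι, _, h, h0, hs, hA⟩ := ih
    choose g g0 gh gx using fun k => exists_component (h0 k) x
    have hx : |x| = x⁺ + x⁻ := (posPart_add_negPart x).symm
    have hsub : ∀ φ : StrongDual ℝ E, φ x = φ x⁺ - φ x⁻ := fun φ => by
      rw [← map_sub, posPart_sub_negPart]
    -- Each piece `h k` is cut in two: `g k` vanishes at `x⁻` and `h k - g k` vanishes at `x⁺`.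
    refine ⟨ι ⊕ ι, inferInstance, Sum.elim g (h - g), ?_, ?_, ?_⟩
    · rintro (k | k)
      · exact g0 k
      · exact fun z hz => sub_nonneg.2 (gh k z hz)
    · simp [hs]
    · intro z hz k
      have hp := posPart_nonneg x
      have hn := negPart_nonneg x
      rcases Finset.mem_insert.1 hz with rfl | hz
      · rcases k with k | k
        · have h1 := gx k
          have h2 := hsub (g k)
          have h3 := gh k _ hp
          have h4 := dual_nonneg_iff.1 (g0 k) _ hn
          have h5 := dual_nonneg_iff.1 (g0 k) _ hp
          simp only [Sum.elim_inl]
          rw [hx, map_add, h2, abs_of_nonneg] <;> linarith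
        · have h1 := gx k
          have h2 := hsub (g k)
          have h3 := gh k _ hp
          have h4 := dual_nonneg_iff.1 (g0 k) _ hn
          have h6 := dual_nonneg_iff.1 (h0 k) _ hn
          have h7 := hsub (h k)
          simp only [Sum.elim_inr, Pi.sub_apply, sub_apply] at *
          rw [hx, map_add, map_add, h7, h2, abs_of_nonpos] <;> linarith
      -- Points treated earlier stay good under refinement: in `|h z| ≤ |g z| + |(h - g) z| ≤ g |z|
      -- + (h - g) |z| = h |z|` the two ends agree, so each summand satisfies equality.
      · have h1 := hA z hz
        have h2 : ∀ k, |g k z| ≤ g k |z| := fun k => abs_apply_le_of_nonneg (g0 k) z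
        have h3 : ∀ k, |(h k - g k) z| ≤ (h k - g k) |z| := fun k =>
          abs_apply_le_of_nonneg (fun z hz => sub_nonneg.2 (gh k z hz)) z
        have h4 : ∀ k, |h k z| ≤ |g k z| + |(h k - g k) z| := fun k => by
          simpa using abs_add_le (g k z) ((h k - g k) z)
        rcases k with k | k
        · have := h1 k; have := h2 k; have := h3 k; have := h4 k
          simp only [Sum.elim_inl, sub_apply] at *
          linarith
        · have := h1 k; have := h2 k; have := h3 k; have := h4 k
          simp only [Sum.elim_inr, Pi.sub_apply, sub_apply] at *
          linarith

end StrongDual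

end BanachLatticeDual

/-- A sequence is weakly null if the norms of its convex combinations are dominated by those of a
weakly null sequence. -/
theorem tendsto_zero_of_norm_sum_le {X Y : Type*} [NormedAddCommGroup X] [NormedSpace ℝ X]
    [NormedAddCommGroup Y] [NormedSpace ℝ Y] {a : ℕ → X} {b : ℕ → Y} (M : ℝ)
    (hab : ∀ (s : Finset ℕ) (c : ℕ → ℝ), (∀ n, 0 ≤ c n) →
      ‖∑ n ∈ s, c n • b n‖ ≤ M * ‖∑ n ∈ s, c n • a n‖)
    (ha : ∀ f : StrongDual ℝ X, Tendsto (fun n => f (a n)) atTop (𝓝 0)) (g : StrongDual ℝ Y) :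
    Tendsto (fun n => g (b n)) atTop (𝓝 0) := by
  classical
  suffices H : ∀ (g : StrongDual ℝ Y) (δ : ℝ), 0 < δ → ∀ᶠ n in atTop, g (b n) < δ by
    refine tendsto_order.2 ⟨fun δ hδ => ?_, H g⟩
    filter_upwards [H (-g) (-δ) (neg_pos.2 hδ)] with n hn
    simpa using hn
  clear g
  intro g δ hδ
  by_contra hcon
  rw [not_eventually] at hcon
  simp only [not_lt] at hcon
  set S : Set ℕ := {n | δ ≤ g (b n)} with hS
  have hpos : 0 < |M| * ‖g‖ + 1 := by positivity
  -- A convex combination of the `b n` with `n ∈ S` has `g`-value at least `δ`, so by `hab` the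
  -- corresponding combination of the `a n` cannot be small. The `+ 1` keeps the radius meaningful
  -- when `M` or `g` vanishes.
  have hdisj : Disjoint (Metric.ball (0 : X) (δ / (|M| * ‖g‖ + 1))) (convexHull ℝ (a '' S)) := by
    rw [Set.disjoint_right]
    intro z hz hz'
    rw [mem_ball_zero_iff, lt_div_iff₀ hpos] at hz'
    -- The points of a convex combination may repeat an index `n`; weights with the same index are
    -- added up.
    have hz2 : z ∈ {z | ∃ (s : Finset ℕ) (c : ℕ → ℝ), (∀ n, 0 ≤ c n) ∧ δ ≤ g (∑ n ∈ s, c n • b n) ∧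
        z = ∑ n ∈ s, c n • a n} := by
      rw [mem_convexHull_iff_exists_fintype] at hz
      obtain ⟨ι, _, w, x, hw, hw1, hx, rfl⟩ := hz
      choose k hkS hk using hx
      refine ⟨Finset.univ.image k, fun n => ∑ i with k i = n, w i,
        fun n => Finset.sum_nonneg fun i _ => hw i, ?_, ?_⟩
      · have e : ∑ n ∈ Finset.univ.image k, (∑ i with k i = n, w i) • b n
            = ∑ i, w i • b (k i) := by
          rw [← Finset.sum_fiberwise_of_maps_to (g := k) (t := Finset.univ.image k)
            (fun i _ => Finset.mem_image_of_mem k (Finset.mem_univ i))]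
          refine Finset.sum_congr rfl fun n _ => ?_
          rw [Finset.sum_smul]
          exact Finset.sum_congr rfl fun i hi => by rw [(Finset.mem_filter.1 hi).2]
        rw [e, map_sum]
        calc δ = ∑ i, w i * δ := by rw [← Finset.sum_mul, hw1, one_mul]
          _ ≤ ∑ i, g (w i • b (k i)) := Finset.sum_le_sum fun i _ => by
            rw [map_smul, smul_eq_mul]
            exact mul_le_mul_of_nonneg_left (hkS i) (hw i)
      · rw [← Finset.sum_fiberwise_of_maps_to (g := k) (t := Finset.univ.image k)
            (fun i _ => Finset.mem_image_of_mem k (Finset.mem_univ i))]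
        refine Finset.sum_congr rfl fun n _ => ?_
        rw [Finset.sum_smul]
        exact Finset.sum_congr rfl fun i hi => by rw [← hk, (Finset.mem_filter.1 hi).2]
    obtain ⟨s, c, hc, hδs, rfl⟩ := hz2
    have h1 : g (∑ n ∈ s, c n • b n) ≤ ‖g‖ * ‖∑ n ∈ s, c n • b n‖ :=
      (le_abs_self _).trans (g.le_opNorm _)
    have h2 := hab s c hc
    have h3 := mul_le_mul_of_nonneg_right (le_abs_self M) (norm_nonneg (∑ n ∈ s, c n • a n))
    have h4 := mul_le_mul_of_nonneg_left (h2.trans h3) (norm_nonneg g)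
    nlinarith [norm_nonneg (∑ n ∈ s, c n • a n)]
  -- Separation gives `f (a n) ≥ r > 0` for all `n ∈ S`. Since `S` is infinite, this contradicts `f
  -- (a n) → 0`.
  obtain ⟨f, r, hf0, hf⟩ := geometric_hahn_banach_open (convex_ball _ _) Metric.isOpen_ball
    (convex_convexHull ℝ (a '' S)) hdisj
  have hr : 0 < r := by
    simpa using hf0 0 (Metric.mem_ball_self (div_pos hδ hpos))
  obtain ⟨n, hn, hn'⟩ := (hcon.and_eventually ((tendsto_order.1 (ha f)).2 r hr)).exists
  exact absurd (hf _ (subset_convexHull ℝ _ ⟨n, hn, rfl⟩)) (not_le.2 hn')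

/-! ### The quotient of a vector lattice by the null ideal of a positive functional -/

section NullIdeal

variable {L : Type u} [AddCommGroup L] [Module ℝ L] [Lattice L] [IsOrderedAddMonoid L]
  [IsOrderedModule ℝ L]

theorem LinearMap.mono_of_nonneg {φ : L →ₗ[ℝ] ℝ} (hφ : ∀ a, 0 ≤ a → 0 ≤ φ a) {a b : L}
    (h : a ≤ b) : φ a ≤ φ b := by
  simpa using hφ (b - a) (sub_nonneg.2 h)

theorem LinearMap.abs_apply_le_of_nonneg {φ : L →ₗ[ℝ] ℝ} (hφ : ∀ a, 0 ≤ a → 0 ≤ φ a) (a : L) :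
    |φ a| ≤ φ |a| :=
  abs_le'.2 ⟨mono_of_nonneg hφ (le_abs_self a), by
    rw [← map_neg]; exact mono_of_nonneg hφ (neg_le_abs a)⟩

theorem abs_sup_le_abs_add_abs (a b : L) : |a ⊔ b| ≤ |a| + |b| :=
  abs_le'.2 ⟨sup_le ((le_abs_self a).trans (le_add_of_nonneg_right (abs_nonneg b)))
      ((le_abs_self b).trans (le_add_of_nonneg_left (abs_nonneg a))),
    ((neg_le_neg le_sup_left).trans (neg_le_abs a)).trans (le_add_of_nonneg_right (abs_nonneg b))⟩

theorem abs_inf_le_abs_add_abs (a b : L) : |a ⊓ b| ≤ |a| + |b| := by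
  rw [← abs_neg, neg_inf, ← abs_neg a, ← abs_neg b]
  exact abs_sup_le_abs_add_abs _ _

/-- The ideal on which a positive functional vanishes absolutely. -/
def nullIdeal (φ : L →ₗ[ℝ] ℝ) (hφ : ∀ a, 0 ≤ a → 0 ≤ φ a) : Submodule ℝ L where
  carrier := {a | φ |a| = 0}
  zero_mem' := by simp
  add_mem' {a b} ha hb := by
    refine (hφ _ (abs_nonneg _)).antisymm' ?_
    have ha : φ |a| = 0 := ha
    have hb : φ |b| = 0 := hb
    refine (LinearMap.mono_of_nonneg hφ (abs_add_le a b)).trans ?_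
    rw [map_add, ha, hb, add_zero]
  smul_mem' c a ha := by
    have ha : φ |a| = 0 := ha
    change φ |c • a| = 0
    rw [abs_real_smul, map_smul, ha, smul_zero]

variable (φ : L →ₗ[ℝ] ℝ) (hφ : ∀ a, 0 ≤ a → 0 ≤ φ a)

theorem mem_nullIdeal {a : L} : a ∈ nullIdeal φ hφ ↔ φ |a| = 0 := Iff.rfl

/-- The quotient of a vector lattice by the null ideal of a positive functional. -/
def NullQuotient : Type u := L ⧸ nullIdeal φ hφ

namespace NullQuotient

instance : AddCommGroup (NullQuotient φ hφ) := inferInstanceAs (AddCommGroup (L ⧸ nullIdeal φ hφ))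

instance : Module ℝ (NullQuotient φ hφ) := inferInstanceAs (Module ℝ (L ⧸ nullIdeal φ hφ))

/-- The quotient map. -/
def mk : L →ₗ[ℝ] NullQuotient φ hφ := (nullIdeal φ hφ).mkQ

variable {φ hφ}

theorem mk_eq_mk {a b : L} : mk φ hφ a = mk φ hφ b ↔ φ |a - b| = 0 :=
  Submodule.Quotient.eq (nullIdeal φ hφ)

theorem ind {p : NullQuotient φ hφ → Prop} (h : ∀ a, p (mk φ hφ a)) (a) : p a :=
  Submodule.Quotient.induction_on _ a h

theorem abs_sup_sub_sup_le (a b c d : L) : |a ⊔ b - c ⊔ d| ≤ |a - c| + |b - d| := by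
  calc |a ⊔ b - c ⊔ d| = |a ⊔ b - c ⊔ b + (c ⊔ b - c ⊔ d)| := by rw [sub_add_sub_cancel]
    _ ≤ |a ⊔ b - c ⊔ b| + |c ⊔ b - c ⊔ d| := abs_add_le _ _
    _ ≤ |a - c| + |b - d| := by
      refine add_le_add (abs_sup_sub_sup_le_abs _ _ _) ?_
      rw [sup_comm c, sup_comm c]
      exact abs_sup_sub_sup_le_abs _ _ _

variable (φ hφ) in
/-- The supremum on the quotient. -/
protected def sup : NullQuotient φ hφ → NullQuotient φ hφ → NullQuotient φ hφ :=
  Quotient.map₂ (fun a b : L => a ⊔ b) fun a c hac b d hbd => by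
    replace hac : φ |a - c| = 0 := (Submodule.quotientRel_def _).1 hac
    replace hbd : φ |b - d| = 0 := (Submodule.quotientRel_def _).1 hbd
    refine (Submodule.quotientRel_def _).2 ((mem_nullIdeal φ hφ).2 ?_)
    refine (hφ _ (abs_nonneg _)).antisymm' ?_
    refine (LinearMap.mono_of_nonneg hφ (abs_sup_sub_sup_le a b c d)).trans ?_
    rw [map_add, hac, hbd, add_zero]

variable (φ hφ) in
/-- The infimum on the quotient. -/
protected def inf (a b : NullQuotient φ hφ) : NullQuotient φ hφ := -(NullQuotient.sup φ hφ (-a) (-b))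

theorem sup_mk (a b : L) : NullQuotient.sup φ hφ (mk φ hφ a) (mk φ hφ b) = mk φ hφ (a ⊔ b) := rfl

theorem inf_mk (a b : L) : NullQuotient.inf φ hφ (mk φ hφ a) (mk φ hφ b) = mk φ hφ (a ⊓ b) := by
  rw [NullQuotient.inf, ← map_neg, ← map_neg, sup_mk, ← map_neg, neg_sup, neg_neg, neg_neg]

instance : Lattice (NullQuotient φ hφ) :=
  @Lattice.mk' _ ⟨NullQuotient.sup φ hφ⟩ ⟨NullQuotient.inf φ hφ⟩
    (ind fun a => ind fun b => congrArg (mk φ hφ) (sup_comm a b))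
    (ind fun a => ind fun b => ind fun c => congrArg (mk φ hφ) (sup_assoc a b c))
    (ind fun a => ind fun b => by
      change NullQuotient.inf φ hφ _ _ = NullQuotient.inf φ hφ _ _
      rw [inf_mk, inf_mk, inf_comm])
    (ind fun a => ind fun b => ind fun c => by
      change NullQuotient.inf φ hφ (NullQuotient.inf φ hφ _ _) _ =
        NullQuotient.inf φ hφ _ (NullQuotient.inf φ hφ _ _)
      rw [inf_mk, inf_mk, inf_mk, inf_mk, inf_assoc])
    (ind fun a => ind fun b => by
      change NullQuotient.sup φ hφ _ (NullQuotient.inf φ hφ _ _) = _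
      rw [inf_mk, sup_mk, sup_inf_self])
    (ind fun a => ind fun b => by
      change NullQuotient.inf φ hφ _ (NullQuotient.sup φ hφ _ _) = _
      rw [sup_mk, inf_mk, inf_sup_self])

theorem mk_sup (a b : L) : mk φ hφ (a ⊔ b) = mk φ hφ a ⊔ mk φ hφ b := rfl

theorem mk_abs (a : L) : mk φ hφ |a| = |mk φ hφ a| := by
  rw [abs, abs, mk_sup, map_neg]

theorem mk_le_mk {a b : L} : mk φ hφ a ≤ mk φ hφ b ↔ φ (a - b)⁺ = 0 := by
  rw [← sup_eq_right, ← mk_sup, mk_eq_mk, sup_sub, sub_self, ← posPart_def,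
    abs_of_nonneg (posPart_nonneg _)]

instance : IsOrderedAddMonoid (NullQuotient φ hφ) where
  add_le_add_left a b h c := by
    induction a using ind with | h a
    induction b using ind with | h b
    induction c using ind with | h c
    rw [mk_le_mk] at h
    rwa [← map_add, ← map_add, mk_le_mk, add_sub_add_right_eq_sub]

instance : IsOrderedModule ℝ (NullQuotient φ hφ) :=
  have pos : ∀ (c : ℝ), 0 ≤ c → ∀ a : NullQuotient φ hφ, 0 ≤ a → 0 ≤ c • a := by
    intro c hc a ha
    induction a using ind with | h a
    rw [← map_zero (mk φ hφ), mk_le_mk] at ha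
    rw [← map_zero (mk φ hφ), ← map_smul, mk_le_mk]
    rw [zero_sub] at ha ⊢
    rw [← smul_neg, smul_posPart_of_nonneg hc, map_smul, ha, smul_zero]
  { smul_le_smul_of_nonneg_left := fun c hc a b h => by
      simpa [smul_sub] using pos c hc (b - a) (sub_nonneg.2 h)
    smul_le_smul_of_nonneg_right := fun a ha c d h => by
      simpa [sub_smul] using pos (d - c) (sub_nonneg.2 h) a ha }

/-- `L` itself may fail to be Archimedean. In the quotient, positive parts are detected by the real
number `φ x⁺`, so the property descends from `ℝ`. -/
theorem isArchimedeanLattice : IsArchimedeanLattice (NullQuotient φ hφ) := by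
  intro x y h
  induction x using ind with | h x
  induction y using ind with | h y
  rw [← map_zero (mk φ hφ), mk_le_mk, sub_zero]
  have key : ∀ n : ℕ, n • φ x⁺ ≤ φ y⁺ := fun n => by
    have hn := h n
    rw [← map_nsmul, mk_le_mk] at hn
    have h1 : n • x⁺ ≤ (n • x - y)⁺ + y⁺ := by
      rw [← Nat.cast_smul_eq_nsmul ℝ, ← Nat.cast_smul_eq_nsmul ℝ,
        ← smul_posPart_of_nonneg n.cast_nonneg]
      refine sup_le ?_ (add_nonneg (posPart_nonneg _) (posPart_nonneg _))
      exact (sub_add_cancel ((n : ℝ) • x) y).symm.le.trans (add_le_add le_sup_left le_sup_left)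
    rw [← map_nsmul]
    refine (LinearMap.mono_of_nonneg hφ h1).trans ?_
    rw [map_add, hn, zero_add]
  refine (hφ _ (posPart_nonneg x)).antisymm' (not_lt.1 fun hpos => ?_)
  obtain ⟨n, hn⟩ := Archimedean.arch (φ y⁺ + 1) hpos
  linarith [key n]

variable (φ hφ) in
/-- The functional induced on the quotient. -/
def functional : NullQuotient φ hφ →ₗ[ℝ] ℝ :=
  (nullIdeal φ hφ).liftQ φ fun a ha => LinearMap.mem_ker.2 <| abs_nonpos_iff.1 <|
    (LinearMap.abs_apply_le_of_nonneg hφ a).trans_eq ha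

theorem functional_mk (a : L) : functional φ hφ (mk φ hφ a) = φ a := rfl

theorem functional_nonneg {a : NullQuotient φ hφ} (ha : 0 ≤ a) : 0 ≤ functional φ hφ a := by
  induction a using ind with | h a
  rw [← map_zero (mk φ hφ), mk_le_mk, zero_sub, posPart_neg] at ha
  rw [functional_mk, ← posPart_sub_negPart a, map_sub, ha, sub_zero]
  exact hφ _ (posPart_nonneg a)

end NullQuotient

end NullIdeal

/-- A positive functional on a vector lattice `L` and a bilinear map into `L` that is a lattice
bimorphism up to the null ideal of the functional induce a positive functional on the vector lattice
tensor product. -/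
theorem FremlinTensor.exists_functional_of_almost_bimorphism {E : Type u} {F : Type v}
    [AddCommGroup E] [Module ℝ E] [Lattice E] [AddCommGroup F] [Module ℝ F] [Lattice F]
    {L : Type (max u v)} [AddCommGroup L] [Module ℝ L] [Lattice L] [IsOrderedAddMonoid L]
    [IsOrderedModule ℝ L] (φ : L →ₗ[ℝ] ℝ) (hφ : ∀ a, 0 ≤ a → 0 ≤ φ a) (ψ : E →ₗ[ℝ] F →ₗ[ℝ] L)
    (hψ : ∀ x y, φ |(|ψ x y| - ψ |x| |y|)| = 0) :
    ∃ J : FremlinTensor E F →ₗ[ℝ] ℝ, (∀ w, 0 ≤ w → 0 ≤ J w) ∧ ∀ x y, J (tmul x y) = φ (ψ x y) := by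
  -- By `hψ` the defect of `ψ` lies in the null ideal, so `ψ` followed by the quotient map is a true
  -- bimorphism with Archimedean target.
  let R : ArchBimorphism E F :=
    { G := NullQuotient φ hφ
      archimedean := NullQuotient.isArchimedeanLattice
      map := ψ.compr₂ (NullQuotient.mk φ hφ)
      isBimorphism := fun x y =>
        (NullQuotient.mk_abs (ψ x y)).symm.trans (NullQuotient.mk_eq_mk.2 (hψ x y)) }
  let ev : FremlinTensor E F →ₗ[ℝ] NullQuotient φ hφ :=
    { toFun := eval R, map_add' := eval_add R, map_smul' := fun c a => eval_smul R a c }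
  exact ⟨NullQuotient.functional φ hφ ∘ₗ ev,
    fun w hw => NullQuotient.functional_nonneg (le_iff.1 hw R), fun x y => rfl⟩

/-! ### Ultralimits of positive functionals -/

section BoundedFamilies

variable {I : Type u} {V : I → Type v} [∀ i, AddCommGroup (V i)] [∀ i, Module ℝ (V i)]
  [∀ i, Lattice (V i)] [∀ i, IsOrderedAddMonoid (V i)] [∀ i, IsOrderedModule ℝ (V i)]
  (p : ∀ i, V i →ₗ[ℝ] ℝ) (hp : ∀ i a, 0 ≤ a → 0 ≤ p i a)

/-- The families `a` for which `p i |a i|` is bounded, where the `p i` are positive functionals. -/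
def boundedFamilies : Submodule ℝ (∀ i, V i) where
  carrier := {a | ∃ C, ∀ i, p i |a i| ≤ C}
  zero_mem' := ⟨0, fun i => by simp⟩
  add_mem' := by
    rintro a b ⟨C, hC⟩ ⟨D, hD⟩
    refine ⟨C + D, fun i => ((p i).mono_of_nonneg (hp i) (abs_add_le (a i) (b i))).trans ?_⟩
    rw [map_add]
    exact add_le_add (hC i) (hD i)
  smul_mem' := by
    rintro c a ⟨C, hC⟩
    refine ⟨|c| * C, fun i => ?_⟩
    rw [Pi.smul_apply, abs_real_smul, map_smul]
    exact mul_le_mul_of_nonneg_left (hC i) (abs_nonneg c)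

namespace boundedFamilies

variable {p hp}

theorem mem_of_abs_le {a b c : ∀ i, V i} (ha : a ∈ boundedFamilies p hp)
    (hb : b ∈ boundedFamilies p hp) (h : ∀ i, |c i| ≤ |a i| + |b i|) :
    c ∈ boundedFamilies p hp := by
  obtain ⟨C, hC⟩ := ha
  obtain ⟨D, hD⟩ := hb
  refine ⟨C + D, fun i => ((p i).mono_of_nonneg (hp i) (h i)).trans ?_⟩
  rw [map_add]
  exact add_le_add (hC i) (hD i)

instance : Lattice (boundedFamilies p hp) :=
  Subtype.lattice
    (fun a b ha hb => mem_of_abs_le ha hb fun i => abs_sup_le_abs_add_abs (a i) (b i))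
    (fun a b ha hb => mem_of_abs_le ha hb fun i => abs_inf_le_abs_add_abs (a i) (b i))

instance : IsOrderedAddMonoid (boundedFamilies p hp) where
  add_le_add_left _ _ h _ i := add_le_add_left (h i) _

instance : IsOrderedModule ℝ (boundedFamilies p hp) where
  smul_le_smul_of_nonneg_left _ hc _ _ h i := smul_le_smul_of_nonneg_left (h i) hc
  smul_le_smul_of_nonneg_right _ ha _ _ h i := smul_le_smul_of_nonneg_right h (ha i)

/-- The values stay in the compact interval `[-C, C]`, where every ultrafilter converges. -/
theorem exists_tendsto (U : Ultrafilter I) (a : boundedFamilies p hp) :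
    ∃ l, Tendsto (fun i => p i (a.1 i)) U (𝓝 l) := by
  obtain ⟨C, hC⟩ := a.2
  obtain ⟨l, -, hl⟩ := (isCompact_Icc (a := -C) (b := C)).ultrafilter_le_nhds
    (U.map fun i => p i (a.1 i)) (by
      rw [le_principal_iff, Ultrafilter.mem_coe, Ultrafilter.mem_map]
      exact univ_mem' fun i =>
        abs_le.1 (((p i).abs_apply_le_of_nonneg (hp i) (a.1 i)).trans (hC i)))
  exact ⟨l, hl⟩

variable (p hp) in
/-- The limit of a bounded family of positive functionals along an ultrafilter. -/
def ultralimit (U : Ultrafilter I) : boundedFamilies p hp →ₗ[ℝ] ℝ where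
  toFun a := (exists_tendsto U a).choose
  map_add' a b := tendsto_nhds_unique (exists_tendsto U (a + b)).choose_spec <| by
    simpa using (exists_tendsto U a).choose_spec.add (exists_tendsto U b).choose_spec
  map_smul' c a := tendsto_nhds_unique (exists_tendsto U (c • a)).choose_spec <| by
    simpa using (exists_tendsto U a).choose_spec.const_mul c

theorem tendsto_ultralimit (U : Ultrafilter I) (a : boundedFamilies p hp) :
    Tendsto (fun i => p i (a.1 i)) U (𝓝 (ultralimit p hp U a)) :=
  (exists_tendsto U a).choose_spec

theorem ultralimit_nonneg (U : Ultrafilter I) (a : boundedFamilies p hp) (ha : 0 ≤ a) :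
    0 ≤ ultralimit p hp U a :=
  ge_of_tendsto' (tendsto_ultralimit U a) fun i => hp i _ (ha i)

end boundedFamilies

end BoundedFamilies

/-! ### Positive functionals on the positive projective tensor product -/

section TensorFunctionals

set_option maxSynthPendingDepth 3

variable {E : Type u} {F : Type v} [NormedAddCommGroup E] [NormedSpace ℝ E] [Lattice E]
  [IsOrderedAddMonoid E] [IsOrderedModule ℝ E] [HasSolidNorm E]
  [NormedAddCommGroup F] [NormedSpace ℝ F] [Lattice F]
  [IsOrderedAddMonoid F] [IsOrderedModule ℝ F] [HasSolidNorm F]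

namespace FremlinTensor

/-- The product of two positive functionals extends to a positive functional on the vector lattice
tensor product. -/
theorem exists_mul_functional {f : StrongDual ℝ E} (hf : 0 ≤ f) {g : StrongDual ℝ F} (hg : 0 ≤ g) :
    ∃ J : FremlinTensor E F →ₗ[ℝ] ℝ, (∀ w, 0 ≤ w → 0 ≤ J w) ∧
      ∀ x y, J (tmul x y) = f x * g y := by
  choose ι _ h h0 hs hA using StrongDual.exists_partition hf
  have : ∀ A, IsOrderedModule ℝ (ι A → F) := fun A =>
    { smul_le_smul_of_nonneg_left := fun c hc a b hab k => smul_le_smul_of_nonneg_left (hab k) hc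
      smul_le_smul_of_nonneg_right := fun a ha c d hcd k =>
        smul_le_smul_of_nonneg_right hcd (ha k) }
  -- Applied to the family `h A k x • y`, this sum is `f x * g y` for every `A`, because the pieces
  -- `h A k` add up to `f`.
  let p : ∀ A, (ι A → F) →ₗ[ℝ] ℝ := fun A => ∑ k, (g : F →ₗ[ℝ] ℝ) ∘ₗ LinearMap.proj k
  have p_apply : ∀ A a, p A a = ∑ k, g (a k) := fun A a => by simp [p]
  have hp : ∀ A a, 0 ≤ a → 0 ≤ p A a := fun A a ha => by
    rw [p_apply]
    exact Finset.sum_nonneg fun k _ => dual_nonneg_iff.1 hg _ (ha k)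
  have hsum : ∀ A z, ∑ k, h A k z = f z := fun A z => by
    rw [← hs A, sum_apply]
  have hmem : ∀ (x : E) (y : F), (fun A k => h A k x • y) ∈ boundedFamilies p hp := fun x y => by
    refine ⟨f |x| * g |y|, fun A => ?_⟩
    rw [p_apply, ← hsum A, Finset.sum_mul]
    refine Finset.sum_le_sum fun k _ => ?_
    rw [Pi.abs_apply, abs_real_smul, map_smul, smul_eq_mul]
    exact mul_le_mul_of_nonneg_right (StrongDual.abs_apply_le_of_nonneg (h0 A k) x)
      (dual_nonneg_iff.1 hg _ (abs_nonneg y))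
  let ψ : E →ₗ[ℝ] F →ₗ[ℝ] boundedFamilies p hp := LinearMap.mk₂ ℝ (fun x y => ⟨_, hmem x y⟩)
    (fun x x' y => Subtype.ext <| funext fun A => funext fun k => by simp [add_smul])
    (fun c x y => Subtype.ext <| funext fun A => funext fun k => by simp [mul_smul])
    (fun x y y' => Subtype.ext <| funext fun A => funext fun k => by simp)
    (fun c x y => Subtype.ext <| funext fun A => funext fun k => smul_comm _ _ _)
  have hψ : ∀ x y A k, (ψ x y).1 A k = h A k x • y := fun x y A k => rfl
  -- An ultrafilter finer than `atTop` sees only finite sets containing a given `x`. There `|h A k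
  -- x| = h A k |x|`, so the bimorphism defect at `(x, y)` is eventually zero.
  let U : Ultrafilter (Finset E) := Ultrafilter.of atTop
  obtain ⟨J, hJ, hJψ⟩ := exists_functional_of_almost_bimorphism
    (boundedFamilies.ultralimit p hp U) (boundedFamilies.ultralimit_nonneg U) ψ (fun x y => by
      refine tendsto_nhds_unique (boundedFamilies.tendsto_ultralimit U _)
        (tendsto_const_nhds.congr' (Ultrafilter.of_le _ ?_))
      filter_upwards [eventually_ge_atTop {x}] with A hxA
      rw [p_apply]
      refine (Finset.sum_eq_zero fun k _ => ?_).symm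
      have e : |h A k x • y| = h A k |x| • |y| := by
        rw [abs_real_smul, hA A x (Finset.singleton_subset_iff.1 hxA)]
      change g |(|h A k x • y| - h A k |x| • |y|)| = 0
      rw [e, sub_self, abs_zero, map_zero])
  refine ⟨J, hJ, fun x y => ?_⟩
  rw [hJψ]
  refine tendsto_nhds_unique (boundedFamilies.tendsto_ultralimit U _)
    (tendsto_const_nhds.congr fun A => ?_)
  rw [p_apply]
  simp only [hψ, map_smul, smul_eq_mul]
  rw [← Finset.sum_mul, hsum]

/-- A positive `J` can be tested on any dominating sum `|w| ≤ ∑ x k ⊗ y k`, and the norm is the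
infimum over these sums. -/
theorem abs_functional_le {J : FremlinTensor E F →ₗ[ℝ] ℝ} (hJ : ∀ w, 0 ≤ w → 0 ≤ J w) {M : ℝ}
    (hM : 0 ≤ M) (h : ∀ x y, 0 ≤ x → 0 ≤ y → J (tmul x y) ≤ M * (‖x‖ * ‖y‖))
    (w : FremlinTensor E F) : |J w| ≤ M * ‖w‖ := by
  have key : ∀ r ∈ dominatingSums w, |J w| ≤ M * r := by
    rintro _ ⟨n, x, y, hx, hy, hw, rfl⟩
    refine ((J.abs_apply_le_of_nonneg hJ w).trans (J.mono_of_nonneg hJ hw)).trans ?_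
    rw [map_sum, Finset.mul_sum]
    exact Finset.sum_le_sum fun k _ => h _ _ (hx k) (hy k)
  rcases hM.eq_or_lt with rfl | hM
  · obtain ⟨r, hr⟩ := dominatingSums_nonempty w
    simpa using key r hr
  · rw [norm_def, ← div_le_iff₀' hM]
    exact le_csInf (dominatingSums_nonempty w) fun r hr => (div_le_iff₀' hM).2 (key r hr)

theorem norm_tmul_le (x : E) (y : F) : ‖tmul x y‖ ≤ ‖x‖ * ‖y‖ := by
  refine csInf_le (bddBelow_dominatingSums _) ⟨1, fun _ => |x|, fun _ => |y|,
    fun _ => abs_nonneg x, fun _ => abs_nonneg y, (abs_tmul x y).le.trans (by simp), ?_⟩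
  simp [norm_abs_eq_norm]

theorem tmul_nonneg {x : E} {y : F} (hx : 0 ≤ x) (hy : 0 ≤ y) : 0 ≤ tmul x y := by
  rw [← abs_of_nonneg hx, ← abs_of_nonneg hy, ← abs_tmul]
  exact abs_nonneg _

end FremlinTensor

namespace PosProjTensor

open FremlinTensor (tmul)

theorem of_nonneg {w : FremlinTensor E F} (hw : 0 ≤ w) : 0 ≤ of w := by
  rw [← sup_eq_left.2 hw, of_sup, map_zero]
  exact le_sup_right

/-- The canonical bilinear map into the positive projective tensor product. -/
def tmulL : E →L[ℝ] F →L[ℝ] PosProjTensor E F :=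
  LinearMap.mkContinuous₂ (LinearMap.mk₂ ℝ (fun x y => of (tmul x y))
    (fun x x' y => by
      rw [← map_add]
      exact congrArg of (FremlinTensor.ext fun R => by
        simp [FremlinTensor.eval_add, FremlinTensor.eval_tmul]))
    (fun c x y => by rw [← map_smul, FremlinTensor.smul_tmul])
    (fun x y y' => by
      rw [← map_add]
      exact congrArg of (FremlinTensor.ext fun R => by
        simp [FremlinTensor.eval_add, FremlinTensor.eval_tmul]))
    (fun c x y => by
      rw [← map_smul]
      exact congrArg of (FremlinTensor.ext fun R => by
        simp [FremlinTensor.eval_smul, FremlinTensor.eval_tmul]))) 1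
    fun x y => by
      rw [LinearMap.mk₂_apply, LinearIsometry.norm_map, one_mul]
      exact FremlinTensor.norm_tmul_le x y

theorem tmulL_apply (x : E) (y : F) : tmulL x y = of (tmul x y) := rfl

theorem tmulL_nonneg {x : E} {y : F} (hx : 0 ≤ x) (hy : 0 ≤ y) : 0 ≤ tmulL x y :=
  of_nonneg (FremlinTensor.tmul_nonneg hx hy)

theorem norm_tmulL_le (x : E) (y : F) : ‖tmulL x y‖ ≤ ‖x‖ * ‖y‖ := by
  rw [tmulL_apply, LinearIsometry.norm_map]
  exact FremlinTensor.norm_tmul_le x y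

/-- The norm of a positive functional is determined by its values at elementary tensors. -/
theorem norm_functional_le {φ : StrongDual ℝ (PosProjTensor E F)} (hφ : 0 ≤ φ) {M : ℝ} (hM : 0 ≤ M)
    (h : ∀ x y, 0 ≤ x → 0 ≤ y → φ (tmulL x y) ≤ M * (‖x‖ * ‖y‖)) : ‖φ‖ ≤ M := by
  refine φ.opNorm_le_bound hM ?_
  refine ind₁ (isClosed_le (by fun_prop) (by fun_prop)) fun w => ?_
  rw [LinearIsometry.norm_map]
  exact FremlinTensor.abs_functional_le (J := (φ : PosProjTensor E F →ₗ[ℝ] ℝ) ∘ₗ of.toLinearMap)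
    (fun w hw => dual_nonneg_iff.1 hφ _ (of_nonneg hw)) hM h w

/-- The product of two positive functionals extends to a positive functional on the positive
projective tensor product. -/
theorem exists_mul_functional {f : StrongDual ℝ E} (hf : 0 ≤ f) {g : StrongDual ℝ F} (hg : 0 ≤ g) :
    ∃ φ : StrongDual ℝ (PosProjTensor E F), 0 ≤ φ ∧ ∀ x y, φ (tmulL x y) = f x * g y := by
  obtain ⟨J, hJ, hJt⟩ := FremlinTensor.exists_mul_functional hf hg
  have hbd := FremlinTensor.abs_functional_le hJ (mul_nonneg (norm_nonneg f) (norm_nonneg g))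
    fun x y hx hy => by
      rw [hJt, mul_mul_mul_comm]
      exact mul_le_mul ((le_abs_self _).trans (f.le_opNorm x))
        ((le_abs_self _).trans (g.le_opNorm y)) (dual_nonneg_iff.1 hg y hy) (by positivity)
  let φ : StrongDual ℝ (PosProjTensor E F) :=
    (J.mkContinuous _ hbd).extend (of : FremlinTensor E F →ₗᵢ[ℝ] _).toContinuousLinearMap
  have hφ : ∀ w, φ (of w) = J w := fun w =>
    ContinuousLinearMap.extend_eq (e := (of : FremlinTensor E F →ₗᵢ[ℝ] _).toContinuousLinearMap)
      (J.mkContinuous _ hbd) denseRange_of of.isometry.isUniformInducing w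
  refine ⟨φ, fun a ha => ?_, fun x y => (hφ _).trans (hJt x y)⟩
  -- Positivity is stated for `a ⊔ 0` so that it becomes a closed condition on all `a`, to be
  -- checked on the dense image of `of`.
  have key : ∀ a : PosProjTensor E F, 0 ≤ φ (a.sup 0) := by
    refine ind₁ (isClosed_le continuous_const
      (φ.continuous.comp (continuous_sup continuous_id continuous_const))) fun w => ?_
    rw [← map_zero of, sup_of, hφ]
    exact hJ _ le_sup_right
  have := key a
  rwa [show a.sup 0 = a from sup_eq_left.2 ha] at this

end PosProjTensor

/-! ### Sequences of operators on the bidual -/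

theorem StrongDual.inclusionInDoubleDual_nonneg {y : F} (hy : 0 ≤ y) :
    0 ≤ NormedSpace.inclusionInDoubleDual ℝ F y := fun _ hf => dual_nonneg_iff.1 hf y hy

/-- If `E*` and `F*` have the PSP, then a sequence of positive adjoint operators `F** → E*` that is
null for the weak operator topology is norm null. -/
theorem tendsto_norm_zero_of_hasPSP (hE : HasPSP (StrongDual ℝ E)) (hF : HasPSP (StrongDual ℝ F))
    {T : ℕ → StrongDual ℝ (StrongDual ℝ F) →L[ℝ] StrongDual ℝ E}
    (hpos : ∀ n, IsPositiveOperator (T n))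
    (hadj : ∀ n x, ∃ r : StrongDual ℝ F, ∀ y, T n y x = y r)
    (hT : ∀ y (g : StrongDual ℝ (StrongDual ℝ E)), Tendsto (fun n => g (T n y)) atTop (𝓝 0)) :
    Tendsto (fun n => ‖T n‖) atTop (𝓝 0) := by
  choose r hr using hadj
  have strong : ∀ y, Tendsto (fun n => ‖T n y‖) atTop (𝓝 0) := by
    intro y
    obtain ⟨p, q, hp, hq, rfl⟩ := StrongDual.exists_nonneg_sub_bidual y
    have hp' := hE (fun n => T n p) (fun n => hpos n p hp) (hT p)
    have hq' := hE (fun n => T n q) (fun n => hpos n q hq) (hT q)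
    refine squeeze_zero (fun n => norm_nonneg _) (fun n => ?_) (by simpa using hp'.add hq')
    rw [map_sub]
    exact norm_sub_le _ _
  -- Restricting to `x ≥ 0` costs a factor 2, through `x = x⁺ - x⁻`. The constant 4 leaves room for
  -- the contradiction `‖T n‖ ≤ ‖T n‖ / 2`.
  have norming : ∀ n, ∃ x : E, 0 ≤ x ∧ ‖x‖ ≤ 1 ∧ ‖T n‖ ≤ 4 * ‖r n x‖ := by
    intro n
    by_contra! hlt
    have hTn : 0 < ‖T n‖ :=
      (mul_nonneg (by norm_num) (norm_nonneg (r n 0))).trans_lt (hlt 0 le_rfl (by simp))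
    have hbd : ∀ y, ∀ x : E, 0 ≤ x → |T n y x| ≤ ‖T n‖ / 4 * ‖y‖ * ‖x‖ := by
      intro y x hx
      rcases eq_or_ne x 0 with rfl | hx0
      · simp
      have hxn : 0 < ‖x‖ := norm_pos_iff.2 hx0
      have h1 := hlt (‖x‖⁻¹ • x) (smul_nonneg (inv_nonneg.2 hxn.le) hx)
        (by rw [norm_smul, norm_inv, norm_norm, inv_mul_cancel₀ hxn.ne'])
      have h2 := y.le_opNorm (r n (‖x‖⁻¹ • x))
      rw [← hr, map_smul, norm_smul, norm_inv, norm_norm, inv_mul_le_iff₀ hxn,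
        Real.norm_eq_abs] at h2
      refine h2.trans ?_
      rw [mul_comm]
      refine mul_le_mul_of_nonneg_right ?_ hxn.le
      rw [mul_comm]
      exact mul_le_mul_of_nonneg_right (by linarith) (norm_nonneg y)
    have : ‖T n‖ ≤ ‖T n‖ / 2 := by
      refine (T n).opNorm_le_bound (by positivity) fun y => ?_
      refine (T n y).opNorm_le_bound (by positivity) fun x => ?_
      have h1 := hbd y _ (posPart_nonneg x)
      have h2 := hbd y _ (negPart_nonneg x)
      have hc : 0 ≤ ‖T n‖ / 4 * ‖y‖ := by positivity
      have h3 := mul_le_mul_of_nonneg_left (norm_posPart_le_norm x) hc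
      have h4 := mul_le_mul_of_nonneg_left (norm_negPart_le_norm x) hc
      have h5 := abs_sub (T n y x⁺) (T n y x⁻)
      rw [← map_sub, posPart_sub_negPart] at h5
      rw [Real.norm_eq_abs]
      linarith
    linarith
  choose x hx hx1 hxT using norming
  -- Strong convergence is what allows the point `x n` to vary: `y (r n (x n)) = T n y (x n)` is at
  -- most `‖T n y‖` in absolute value.
  have hnull : Tendsto (fun n => ‖r n (x n)‖) atTop (𝓝 0) := by
    refine hF _ (fun n y hy => ?_) fun y => ?_
    · have := hpos n _ (StrongDual.inclusionInDoubleDual_nonneg hy) _ (hx n)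
      rwa [hr] at this
    · refine squeeze_zero_norm (fun n => ?_) (strong y)
      rw [← hr]
      refine ((T n y).le_opNorm (x n)).trans ?_
      exact mul_le_of_le_one_right (norm_nonneg _) (hx1 n)
  exact squeeze_zero (fun n => norm_nonneg _) hxT (by simpa using hnull.const_mul 4)

/-- A weak*-weak* continuous operator `X* → Y*` is an adjoint operator. -/
theorem IsWeakStarContinuous.exists_apply_eq {X Y : Type*} [NormedAddCommGroup X] [NormedSpace ℝ X]
    [NormedAddCommGroup Y] [NormedSpace ℝ Y] {T : StrongDual ℝ X →L[ℝ] StrongDual ℝ Y}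
    (hT : IsWeakStarContinuous T) (y : Y) : ∃ x : X, ∀ φ, T φ y = φ x := by
  let ev : StrongDual ℝ (WeakDual ℝ X) :=
    -- A weak* continuous functional on `X*` is evaluation at a point of `X`.
    { toFun := fun φ => T (WeakDual.toStrongDual φ) y
      map_add' := fun φ χ => by simp
      map_smul' := fun c φ => by simp
      cont := (WeakDual.eval_continuous y).comp hT }
  obtain ⟨x, hx⟩ := LinearMap.dualEmbedding_surjective (topDualPairing ℝ X) ev
  exact ⟨x, fun φ => (DFunLike.congr_fun hx (StrongDual.toWeakDual φ)).symm⟩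

theorem hasWotPSP_of_hasPSP (hE : HasPSP (StrongDual ℝ E)) (hF : HasPSP (StrongDual ℝ F)) :
    HasWotPSP (regularWeakStarOperators (StrongDual ℝ F) E) := fun _ hmem hpos hT =>
  tendsto_norm_zero_of_hasPSP hE hF hpos (fun n x => (hmem n).2.exists_apply_eq x) hT

/-- The assignment `χ ↦ T χ` is linear and bounded, so weakly null functionals go to operators that
are null for the weak operator topology. Evaluating `T (φ n)` at the canonical images of `y ∈ F`
recovers `φ n` on elementary tensors, which controls `‖φ n‖` by positivity. -/
theorem hasPSP_posProjTensor (hE : HasPSP (StrongDual ℝ E)) (hF : HasPSP (StrongDual ℝ F)) :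
    HasPSP (StrongDual ℝ (PosProjTensor E F)) := by
  intro φ hφ hφw
  let R : StrongDual ℝ (PosProjTensor E F) →L[ℝ] E →L[ℝ] StrongDual ℝ F :=
    ((ContinuousLinearMap.compL ℝ E (F →L[ℝ] PosProjTensor E F) (StrongDual ℝ F)).flip
      PosProjTensor.tmulL).comp (ContinuousLinearMap.compL ℝ F (PosProjTensor E F) ℝ)
  have R_apply : ∀ χ x y, R χ x y = χ (PosProjTensor.tmulL x y) := fun χ x y => rfl
  let T : StrongDual ℝ (PosProjTensor E F) →L[ℝ]
      StrongDual ℝ (StrongDual ℝ F) →L[ℝ] StrongDual ℝ E :=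
    (ContinuousLinearMap.compL ℝ E (StrongDual ℝ F) ℝ).flip.comp R
  have T_apply : ∀ χ y x, T χ y x = y (R χ x) := fun χ y x => rfl
  have hT := tendsto_norm_zero_of_hasPSP hE hF (T := fun n => T (φ n))
    (fun n y hy x hx => dual_nonneg_iff.1 hy _ fun z hz =>
      dual_nonneg_iff.1 (hφ n) _ (PosProjTensor.tmulL_nonneg hx hz))
    (fun n x => ⟨R (φ n) x, fun y => rfl⟩)
    (fun y g => hφw (g.comp (T.flip y)))
  refine squeeze_zero (fun n => norm_nonneg _) (fun n => ?_) hT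
  refine PosProjTensor.norm_functional_le (hφ n) (norm_nonneg _) fun x y _ _ => ?_
  have h1 := (T (φ n)).le_opNorm (NormedSpace.inclusionInDoubleDual ℝ F y)
  have h2 := (T (φ n) (NormedSpace.inclusionInDoubleDual ℝ F y)).le_opNorm x
  have h3 := NormedSpace.double_dual_bound ℝ F y
  have h4 : T (φ n) (NormedSpace.inclusionInDoubleDual ℝ F y) x = φ n (PosProjTensor.tmulL x y) :=
    rfl
  rw [← h4]
  calc _ ≤ ‖T (φ n) (NormedSpace.inclusionInDoubleDual ℝ F y)‖ * ‖x‖ := (le_abs_self _).trans h2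
    _ ≤ ‖T (φ n)‖ * ‖y‖ * ‖x‖ := mul_le_mul_of_nonneg_right
      (h1.trans (mul_le_mul_of_nonneg_left h3 (norm_nonneg _))) (norm_nonneg x)
    _ = _ := by ring

/-- Rank one operators `y ↦ y(g) f` are regular and weak*-weak* continuous. -/
theorem smulRight_mem_regularWeakStarOperators {f : StrongDual ℝ E} (hf : 0 ≤ f)
    {g : StrongDual ℝ F} (hg : 0 ≤ g) :
    IsPositiveOperator ((NormedSpace.inclusionInDoubleDual ℝ (StrongDual ℝ F) g).smulRight f) ∧
      (NormedSpace.inclusionInDoubleDual ℝ (StrongDual ℝ F) g).smulRight f ∈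
        regularWeakStarOperators (StrongDual ℝ F) E := by
  have hpos : IsPositiveOperator
      ((NormedSpace.inclusionInDoubleDual ℝ (StrongDual ℝ F) g).smulRight f) := fun y hy x hx =>
    mul_nonneg (dual_nonneg_iff.1 hy g hg) (dual_nonneg_iff.1 hf x hx)
  refine ⟨hpos, ⟨_, 0, hpos, fun _ _ => le_rfl, (sub_zero _).symm⟩, ?_⟩
  refine WeakDual.continuous_of_continuous_eval fun x => ?_
  exact (WeakDual.eval_continuous g).mul_const (f x)

theorem norm_inclusionInDoubleDual_pos {g : StrongDual ℝ F} (hg : g ≠ 0) :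
    0 < ‖NormedSpace.inclusionInDoubleDual ℝ (StrongDual ℝ F) g‖ := by
  obtain ⟨y, -, hy⟩ := exists_dual_vector ℝ g (norm_ne_zero_iff.2 hg)
  refine norm_pos_iff.2 fun h => hg (norm_eq_zero.1 ?_)
  have : NormedSpace.inclusionInDoubleDual ℝ (StrongDual ℝ F) g y = 0 := by rw [h]; rfl
  rw [NormedSpace.dual_def, hy] at this
  simpa using this

theorem tendsto_zero_of_const_mul {a : ℕ → ℝ} {c : ℝ} (hc : c ≠ 0)
    (h : Tendsto (fun n => c * a n) atTop (𝓝 0)) : Tendsto a atTop (𝓝 0) := by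
  simpa [hc] using h.const_mul c⁻¹

/-- The rank one operator built from `f` and `g` has norm `‖g‖ * ‖f‖`; keeping one nonzero factor
fixed transfers norm convergence to the other. -/
theorem hasPSP_of_hasWotPSP [Nontrivial E] [Nontrivial F]
    (h : HasWotPSP (regularWeakStarOperators (StrongDual ℝ F) E)) :
    HasPSP (StrongDual ℝ E) ∧ HasPSP (StrongDual ℝ F) := by
  obtain ⟨f, hf, x, -, hfx⟩ := StrongDual.exists_nonneg_pos E
  obtain ⟨g, hg, y, -, hgy⟩ := StrongDual.exists_nonneg_pos F
  have hf0 : f ≠ 0 := fun h0 => by simp [h0] at hfx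
  have hg0 : g ≠ 0 := fun h0 => by simp [h0] at hgy
  constructor
  · intro a ha haw
    have key := h _ (fun n => (smulRight_mem_regularWeakStarOperators (ha n) hg).2)
      (fun n => (smulRight_mem_regularWeakStarOperators (ha n) hg).1) fun y G => by
        simpa using (haw G).const_mul (y g)
    simp only [ContinuousLinearMap.norm_smulRight_apply] at key
    exact tendsto_zero_of_const_mul (norm_inclusionInDoubleDual_pos hg0).ne' key
  · intro b hb hbw
    have key := h _ (fun n => (smulRight_mem_regularWeakStarOperators hf (hb n)).2)
      (fun n => (smulRight_mem_regularWeakStarOperators hf (hb n)).1) fun y G => by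
        simpa using (hbw y).mul_const (G f)
    simp only [ContinuousLinearMap.norm_smulRight_apply] at key
    refine (tendsto_zero_of_const_mul (norm_ne_zero_iff.2 hf0)
      (key.congr fun n => mul_comm _ _)).congr fun n => ?_
    exact (NormedSpace.inclusionInDoubleDualLi ℝ (E := StrongDual ℝ F)).norm_map (b n)

/-- If products of a positive weakly null sequence with a fixed positive functional are realised by
positive functionals on the tensor product, then these are weakly null. -/
theorem tendsto_zero_of_mul_functional {X : Type*} [NormedAddCommGroup X] [NormedSpace ℝ X]
    {a : ℕ → X} (ha : ∀ f : StrongDual ℝ X, Tendsto (fun n => f (a n)) atTop (𝓝 0))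
    {φ : ℕ → StrongDual ℝ (PosProjTensor E F)} (hφ : ∀ n, 0 ≤ φ n) (S : E → F → StrongDual ℝ X)
    {M : ℝ} (hM : 0 ≤ M) (hS : ∀ x y, ‖S x y‖ ≤ M * (‖x‖ * ‖y‖))
    (hφS : ∀ n x y, φ n (PosProjTensor.tmulL x y) = S x y (a n))
    (Φ : StrongDual ℝ (StrongDual ℝ (PosProjTensor E F))) :
    Tendsto (fun n => Φ (φ n)) atTop (𝓝 0) := by
  -- The `φ n` are not given as images of the `a n` under a bounded linear map, so `Φ` cannot be
  -- pulled back to `X*`. Combinations with nonnegative coefficients are still positive, so their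
  -- norms can be read off elementary tensors.
  refine tendsto_zero_of_norm_sum_le M (fun s c hc => ?_) ha Φ
  refine PosProjTensor.norm_functional_le (fun w hw => ?_) (by positivity) fun x y _ _ => ?_
  · simp only [sum_apply]
    exact Finset.sum_nonneg fun n _ => mul_nonneg (hc n) (dual_nonneg_iff.1 (hφ n) w hw)
  · have e : (∑ n ∈ s, c n • φ n) (PosProjTensor.tmulL x y) = S x y (∑ n ∈ s, c n • a n) := by
      simp [hφS]
    rw [e]
    refine ((le_abs_self _).trans ((S x y).le_opNorm _)).trans ?_
    refine (mul_le_mul_of_nonneg_right (hS x y) (norm_nonneg _)).trans_eq ?_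
    ring

/-- The functionals `a n ⊗ g` and `f ⊗ b n` are positive and weakly null, hence norm null. Fixing a
vector at which `g`, respectively `f`, is positive bounds `‖a n‖`, respectively `‖b n‖`, by a
constant multiple of their norms. -/
theorem hasPSP_of_hasPSP_posProjTensor [Nontrivial E] [Nontrivial F]
    (h : HasPSP (StrongDual ℝ (PosProjTensor E F))) :
    HasPSP (StrongDual ℝ E) ∧ HasPSP (StrongDual ℝ F) := by
  obtain ⟨f, hf, x, -, hfx⟩ := StrongDual.exists_nonneg_pos E
  obtain ⟨g, hg, y, -, hgy⟩ := StrongDual.exists_nonneg_pos F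
  constructor
  · intro a ha haw
    choose φ hφ hφt using fun n => PosProjTensor.exists_mul_functional (ha n) hg
    have key := h φ hφ <| tendsto_zero_of_mul_functional haw hφ
      (fun x y => g y • NormedSpace.inclusionInDoubleDual ℝ E x) (norm_nonneg g)
      (fun x y => by
        rw [norm_smul, mul_comm ‖x‖, ← mul_assoc]
        exact mul_le_mul (g.le_opNorm y) (NormedSpace.double_dual_bound ℝ E x) (norm_nonneg _)
          (by positivity))
      (fun n x y => by rw [hφt, mul_comm]; rfl)
    refine squeeze_zero (fun n => norm_nonneg _) (fun n => ?_)
      (by simpa using key.mul_const (‖y‖ / g y))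
    refine (a n).opNorm_le_bound (by positivity) fun z => ?_
    have h1 := (φ n).le_opNorm (PosProjTensor.tmulL z y)
    have h2 := mul_le_mul_of_nonneg_left (PosProjTensor.norm_tmulL_le z y) (norm_nonneg (φ n))
    rw [hφt, norm_mul, Real.norm_of_nonneg hgy.le, ← le_div_iff₀ hgy] at h1
    refine (h1.trans (div_le_div_of_nonneg_right h2 hgy.le)).trans_eq ?_
    ring
  · intro b hb hbw
    choose φ hφ hφt using fun n => PosProjTensor.exists_mul_functional hf (hb n)
    have key := h φ hφ <| tendsto_zero_of_mul_functional hbw hφ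
      (fun x y => f x • NormedSpace.inclusionInDoubleDual ℝ F y) (norm_nonneg f)
      (fun x y => by
        rw [norm_smul, ← mul_assoc]
        exact mul_le_mul (f.le_opNorm x) (NormedSpace.double_dual_bound ℝ F y) (norm_nonneg _)
          (by positivity))
      (fun n x y => by rw [hφt]; rfl)
    refine squeeze_zero (fun n => norm_nonneg _) (fun n => ?_)
      (by simpa using key.mul_const (‖x‖ / f x))
    refine (b n).opNorm_le_bound (by positivity) fun z => ?_
    have h1 := (φ n).le_opNorm (PosProjTensor.tmulL x z)
    have h2 := mul_le_mul_of_nonneg_left (PosProjTensor.norm_tmulL_le x z) (norm_nonneg (φ n))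
    rw [hφt, norm_mul, Real.norm_of_nonneg hfx.le, ← le_div_iff₀' hfx] at h1
    refine (h1.trans (div_le_div_of_nonneg_right h2 hfx.le)).trans_eq ?_
    ring

end TensorFunctionals

end

theorem theorem3p4 {E F : Type*}
    [NormedAddCommGroup E] [NormedSpace ℝ E] [CompleteSpace E] [Lattice E]
    [IsOrderedAddMonoid E] [IsOrderedModule ℝ E] [HasSolidNorm E] [Nontrivial E]
    [NormedAddCommGroup F] [NormedSpace ℝ F] [CompleteSpace F] [Lattice F]
    [IsOrderedAddMonoid F] [IsOrderedModule ℝ F] [HasSolidNorm F] [Nontrivial F] :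
    List.TFAE
      [HasPSP (StrongDual ℝ E) ∧ HasPSP (StrongDual ℝ F),
       HasWotPSP (regularWeakStarOperators (StrongDual ℝ F) E),
       HasPSP (StrongDual ℝ (PosProjTensor E F))] := by
  tfae_have 1 → 2 := fun h => hasWotPSP_of_hasPSP h.1 h.2
  tfae_have 2 → 1 := hasPSP_of_hasWotPSP
  tfae_have 1 → 3 := fun h => hasPSP_posProjTensor h.1 h.2
  tfae_have 3 → 1 := hasPSP_of_hasPSP_posProjTensor
  tfae_finish
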